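/- **Setting.** Let $R$ be a finite commutative chain ring, i.e. a finite commutative local ring whose maximal ideal $M=\langle a\rangle$ is principal. Let $t$ be the nilpotency index of $a$ and $q=|R/M|$. Every $c\in R$ is $c=a^i u$ with $u$ a unit and a unique $0\le i\le t$; put $\|c\|=i$ (so $\|0\|=t$). Let $t_j(X_j)\in R[X_j]$ ($1\le j\le r$) be monic of degree $n_j$, $n=\prod_j n_j$, and $\mathcal A=R[X_1,\dots,X_r]/\langle t_1(X_1),\dots,t_r(X_r)\rangle$. Each element of $\mathcal A$ is identified with its unique representative all of whose exponents $\mathbf i$ satisfy $0\le i_j<n_j$ for all $j$. Fix a monomial order $\preceq$ on $\mathbb N_0^r$. For $f=\sum f_{\mathbf i}\mathbf X^{\mathbf i}\in R[X_1,\dots,X_r]$ let $\mathfrak S(f)$ be its support, $\|f\|=\min_{\mathbf i}\|f_{\mathbf i}\|$, $\mathrm{ldg}(f)$ (for $f\neq0$) the $\preceq$-largest $\mathbf i$ with $\|f_{\mathbf i}\|=\|f\|$, $\mathrm{Lt}(f)=\mathbf X^{\mathrm{ldg}(f)}$, and $\mathrm{Lc}(f)$ the coefficient of $\mathrm{Lt}(f)$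 in $f$. *Normal forms.* For polynomials $f,g$, an $L$-reduction step of $f$ mod $g$ replaces $f$ by $f-c\mathbf X^{\mathbf i}g$, where $c\in R$ and $c\,\mathrm{Lc}(g)\ne 0$ equals the coefficient of $\mathbf X^{\mathbf i}\mathrm{Lt}(g)$ in $f$. A polynomial is normal mod a set $\chi$ if no step mod an element of $\chi$ applies to it; a normal form of $f$ mod $\chi$ is a polynomial normal mod $\chi$ obtained from $f$ by finitely many (possibly zero) steps mod elements of $\chi$. *Krull systems.* A Ferrers diagram is a finite subset $\mathcal F\subset\mathbb N_0^r$ closed downwards for the componentwise order; $\mathcal{KF}$ is the set of minimal elements of $\mathbb N_0^r\setminus\mathcal F$. A Krull system of $\mathcal F$-monic polynomials is a set $\chi=\{g^{\mathbf s}\mid \mathbf s\in\mathcal{KF}\}\subset R[X_1,\dots,X_r]$ with $g^{\mathbf s}=\mathbf X^{\mathbf s}-\sum_{\mathbf u\in\mathcal F}g^{\mathbf s}_{\mathbf u}\mathbf X^{\mathbf u}$, such that reduction mod $M$ is injective on $\chi$ and its image $\overline\chi$ is a reduced Gröbner basis (for $\preceq$) of the ideal $\langle\overline\chi\rangle$ of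 $\mathbb F_q[X_1,\dots,X_r]$. *Codes.* For an $\mathcal A$-submodule $C$ of $\mathcal A^l$ let $\pi_i$ be the $i$-th projection and let $C_i$ be the submodule of the $c\in C$ with $c_1=\dots=c_{i-1}=0$. **Theorem.** Let $C\ne 0$ be an $\mathcal A$-submodule of $\mathcal A^l$. Then there are a number $1\le k\le l$; positions $1\le i_1<\dots<i_k\le l$, which are exactly the $i$ with $\pi_i(C_i)\neq 0$; numbers $0\le x_1,\dots,x_k\le t-1$; and for each $1\le j\le k$ a strictly decreasing chain of Ferrers diagrams $\mathcal F^j_0\supset\dots\supset\mathcal F^j_{x_j}$ contained in $\prod_{j'=1}^r\{0,\dots,n_{j'}-1\}$, integers $0=b^j_0<b^j_1<\dots<b^j_{x_j}<b^j_{x_j+1}=t$, and Krull systems $\chi^j_m$ of $\mathcal F^j_m$-monic polynomials ($0\le m\le x_j$), such that for every $1\le j\le k$: 1. if $f\in\pi_{i_j}(C_{i_j})$, $0\le m\le x_j$ and $\mathfrak S(f)\subseteq\mathcal F^j_m$, then $\|f\|\ge b^j_{m+1}$; 2. $a^{b^j_m}\chi^j_m\subseteq\pi_{i_j}(C_{i_j})$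 (modulo $\langle t_1,\dots,t_r\rangle$) for all $0\le m\le x_j$; 3. the set $\chi^j=\chi^j_0\cup a^{b^j_1}\chi^j_1\cup\dots\cup a^{b^j_{x_j}}\chi^j_{x_j}$ is a canonical generating system of $\pi_{i_j}(C_{i_j})$, i.e. (a) the ideal $\pi_{i_j}(C_{i_j})$ of $\mathcal A$ is generated by $\chi^j$; (b) for every $f\in\mathcal A$ there are sequences with $h_0=f$ and $h_{m+1}$ a normal form of $h_m$ mod $\chi^j_m$ ($0\le m\le x_j$), and for every such sequence: $f\in\pi_{i_j}(C_{i_j})$ if and only if $\|h_m\|\ge b^j_m$ for all $0\le m\le x_j$ and $h_{x_j+1}=0$; (c) with $|\mathcal F^j_{-1}|:=n$, $\;|\pi_{i_j}(C_{i_j})|=q^{\sum_{m=0}^{x_j}(t-b^j_m)(|\mathcal F^j_{m-1}|-|\mathcal F^j_m|)}$. Moreover $|C|=q^{\sum_{j=1}^k\sum_{m=0}^{x_j}(t-b^j_m)(|\mathcal F^j_{m-1}|-|\mathcal F^j_m|)}$, and for all $1\le j\le k$, $0\le m\le x_j$, $g\in\chi^j_m$ there are $h^{j,m,g}_z\in\mathcal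 A$ ($i_j<z\le l$) such that $h^{j,m,g}_{i_{j'}}$ is normal mod $\chi^{j'}$ for every $j<j'\le k$, and the matrix whose rows are $$\bigl(0,\dots,0,\;a^{b^j_m}g,\;h^{j,m,g}_{i_j+1},\dots,h^{j,m,g}_l\bigr)\qquad(a^{b^j_m}g\text{ in position } i_j)$$ for all such $j,m,g$ is a generator matrix of $C$, i.e. its rows generate $C$ as an $\mathcal A$-module. -/

import Mathlib

open scoped Polynomial

noncomputable section

namespace ChainCode

/-! ### The affine algebra and reduced representatives -/

section AffineAlgebra

variable {R : Type*} [CommRing R] {r : ℕ}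

/-- The ideal `⟨t₁(X₁), …, t_r(X_r)⟩` of `R[X₁, …, X_r]`. -/
def definingIdeal (T : Fin r → R[X]) : Ideal (MvPolynomial (Fin r) R) :=
  Ideal.span (Set.range fun i => Polynomial.aeval (MvPolynomial.X i : MvPolynomial (Fin r) R) (T i))

/-- The affine algebra `R[X₁, …, X_r] / ⟨t₁(X₁), …, t_r(X_r)⟩`. -/
abbrev AffineAlgebra (T : Fin r → R[X]) : Type _ :=
  MvPolynomial (Fin r) R ⧸ definingIdeal T

/-- The class of a polynomial in the affine algebra. -/
abbrev toAlg (T : Fin r → R[X]) : MvPolynomial (Fin r) R →+* AffineAlgebra T :=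
  Ideal.Quotient.mk (definingIdeal T)

/-- All exponents of `p` lie in the box `∏ {0, …, n_j - 1}`, where `n_j = deg t_j`. -/
def IsReducedPoly (T : Fin r → R[X]) (p : MvPolynomial (Fin r) R) : Prop :=
  ∀ e ∈ p.support, ∀ j, e j < (T j).natDegree

theorem coeff_aeval_X (i : Fin r) (p : R[X]) (e : Fin r →₀ ℕ) :
    (Polynomial.aeval (MvPolynomial.X i : MvPolynomial (Fin r) R) p).coeff e =
      ∑ k ∈ Finset.range (p.natDegree + 1),
        if Finsupp.single i k = e then p.coeff k else 0 := by
  rw [Polynomial.aeval_eq_sum_range, MvPolynomial.coeff_sum]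
  refine Finset.sum_congr rfl fun k _ => ?_
  rw [MvPolynomial.coeff_smul, MvPolynomial.coeff_X_pow]
  split_ifs <;> simp

/-- Every element of the affine algebra has a reduced representative. -/
theorem exists_reduced (T : Fin r → R[X]) (hT : ∀ j, (T j).Monic) (f : AffineAlgebra T) :
    ∃ p : MvPolynomial (Fin r) R, IsReducedPoly T p ∧ toAlg T p = f := by
  obtain ⟨f, rfl⟩ := Ideal.Quotient.mk_surjective f
  rcases subsingleton_or_nontrivial R with hR | hR
  · exact ⟨0, by simp [IsReducedPoly], by rw [Subsingleton.elim f 0]⟩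
  let m : MonomialOrder (Fin r) := MonomialOrder.lex
  let B : Fin r → MvPolynomial (Fin r) R := fun i => Polynomial.aeval (MvPolynomial.X i) (T i)
  have hc : ∀ i, (B i).coeff (Finsupp.single i (T i).natDegree) = 1 := by
    intro i
    rw [coeff_aeval_X, Finset.sum_eq_single (T i).natDegree]
    · rw [if_pos rfl]
      exact hT i
    · intro k _ hk
      rw [if_neg]
      intro h
      exact hk (Finsupp.single_injective i h)
    · simp
  have hdeg : ∀ i, m.degree (B i) = Finsupp.single i (T i).natDegree := by
    intro i
    apply m.toSyn.injective
    apply le_antisymm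
    · rw [m.degree_le_iff]
      intro e he
      rw [MvPolynomial.mem_support_iff, coeff_aeval_X] at he
      obtain ⟨k, hk, hke⟩ := Finset.exists_ne_zero_of_sum_ne_zero he
      have hek : Finsupp.single i k = e := by
        by_contra h
        simp [h] at hke
      rw [← hek]
      apply m.toSyn_monotone
      exact Finsupp.single_mono (Nat.lt_succ_iff.mp (Finset.mem_range.mp hk))
    · apply m.le_degree
      rw [MvPolynomial.mem_support_iff, hc]
      exact one_ne_zero
  have hlc : ∀ i, IsUnit (m.leadingCoeff (B i)) := by
    intro i
    rw [MonomialOrder.leadingCoeff, hdeg, hc]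
    exact isUnit_one
  obtain ⟨g, p, hf, -, hp⟩ := m.div hlc f
  refine ⟨p, ?_, ?_⟩
  · intro e he j
    have := hp e he j
    rw [hdeg, Finsupp.single_le_iff] at this
    exact not_le.mp this
  · rw [eq_comm, Ideal.Quotient.eq, hf, add_sub_cancel_right, Finsupp.linearCombination_apply]
    refine Submodule.sum_mem _ fun i _ => ?_
    exact Ideal.mul_mem_left _ _ (Ideal.subset_span ⟨i, rfl⟩)

/-- The reduced polynomial with which an element of the affine algebra is identified. -/
def rep (T : Fin r → R[X]) (hT : ∀ j, (T j).Monic) (f : AffineAlgebra T) :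
    MvPolynomial (Fin r) R :=
  (exists_reduced T hT f).choose

end AffineAlgebra

/-! ### Norms and `L`-reduction -/

section Reduction

variable {R : Type*} [CommRing R] {r : ℕ}

open Classical in
/-- The norm of an element of a chain ring whose maximal ideal is generated by `a`: the exponent
`i` in `c = a ^ i * unit`, `0 ≤ i ≤ t`, where `t` is the nilpotency index of `a`; `‖0‖ = t`. -/
def chainNorm (a c : R) : ℕ :=
  Nat.findGreatest (fun i => a ^ i ∣ c) (nilpotencyClass a)

/-- The norm of a polynomial: the minimum of the norms of its coefficients; `‖0‖ = t`. -/
def polyNorm (a : R) (f : MvPolynomial (Fin r) R) : ℕ :=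
  ⨅ e : Fin r →₀ ℕ, chainNorm a (f.coeff e)

/-- `e` is the leading degree of `f`: the largest exponent whose coefficient has norm `‖f‖`. -/
def IsLeadingDegree (ord : MonomialOrder (Fin r)) (a : R) (f : MvPolynomial (Fin r) R)
    (e : Fin r →₀ ℕ) : Prop :=
  chainNorm a (f.coeff e) = polyNorm a f ∧
    ∀ e', chainNorm a (f.coeff e') = polyNorm a f → ord.toSyn e' ≤ ord.toSyn e

/-- `f` is `L`-reduced to `h` mod `g` in one step: `h = f - c X^i g`, where
`0 ≠ c Lc(g) = Cf(f, X^i Lt(g))`. -/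
def LStep (ord : MonomialOrder (Fin r)) (a : R) (g f h : MvPolynomial (Fin r) R) : Prop :=
  ∃ (e i : Fin r →₀ ℕ) (c : R), IsLeadingDegree ord a g e ∧
    c * g.coeff e ≠ 0 ∧ c * g.coeff e = f.coeff (i + e) ∧
    h = f - MvPolynomial.monomial i c * g

/-- `f` is `L`-reduced to `h` mod the set `χ`, in finitely many (possibly zero) steps. -/
def LReduces (ord : MonomialOrder (Fin r)) (a : R) (χ : Set (MvPolynomial (Fin r) R)) :
    MvPolynomial (Fin r) R → MvPolynomial (Fin r) R → Prop :=
  Relation.ReflTransGen fun f h => ∃ g ∈ χ, LStep ord a g f h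

/-- `f` is normal mod `χ`: it cannot be `L`-reduced mod `χ`. -/
def IsNormal (ord : MonomialOrder (Fin r)) (a : R) (χ : Set (MvPolynomial (Fin r) R))
    (f : MvPolynomial (Fin r) R) : Prop :=
  ¬ ∃ h, ∃ g ∈ χ, LStep ord a g f h

/-- The set `NF(f, χ)` of normal forms of `f` mod `χ`. -/
def NF (ord : MonomialOrder (Fin r)) (a : R) (χ : Set (MvPolynomial (Fin r) R))
    (f : MvPolynomial (Fin r) R) : Set (MvPolynomial (Fin r) R) :=
  {h | IsNormal ord a χ h ∧ LReduces ord a χ f h}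

/-- `h 0 = f` and `h (m + 1)` is a normal form of `h m` mod `χ m` for `0 ≤ m ≤ x`. -/
def IsNFSequence (ord : MonomialOrder (Fin r)) (a : R) (x : ℕ)
    (χ : ℕ → Finset (MvPolynomial (Fin r) R)) (f : MvPolynomial (Fin r) R)
    (h : ℕ → MvPolynomial (Fin r) R) : Prop :=
  h 0 = f ∧ ∀ m ≤ x, h (m + 1) ∈ NF ord a (χ m : Set (MvPolynomial (Fin r) R)) (h m)

end Reduction

/-! ### Ferrers diagrams and Krull systems -/

section Krull

variable {r : ℕ}

/-- A Ferrers diagram: a finite subset of `ℕ^r` that is closed under going down. -/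
def IsFerrers (F : Finset (Fin r →₀ ℕ)) : Prop :=
  IsLowerSet (F : Set (Fin r →₀ ℕ))

/-- The set `𝒦F` of minimal elements of the complement of `F`. -/
def corners (F : Finset (Fin r →₀ ℕ)) : Set (Fin r →₀ ℕ) :=
  {s | Minimal (fun e => e ∉ F) s}

/-- `g = X^s - ∑_{u ∈ F} g_u X^u` with `s ∈ 𝒦F`. -/
def IsFerrersMonic {R : Type*} [CommRing R] (F : Finset (Fin r →₀ ℕ)) (s : Fin r →₀ ℕ)
    (g : MvPolynomial (Fin r) R) : Prop :=
  s ∈ corners F ∧ (MvPolynomial.monomial s 1 - g).support ⊆ F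

/-- A characteristic set: `χ = {g^s | s ∈ 𝒦F}` with every `g^s` an `F`-monic polynomial with
exponent `s`. -/
def IsCharacteristicSet {R : Type*} [CommRing R] (F : Finset (Fin r →₀ ℕ))
    (χ : Finset (MvPolynomial (Fin r) R)) : Prop :=
  ∃ G : (Fin r →₀ ℕ) → MvPolynomial (Fin r) R,
    (∀ s ∈ corners F, IsFerrersMonic F s (G s)) ∧ (χ : Set _) = G '' corners F

/-- `B` is a reduced Gröbner basis of the ideal `I` of `K[X₁, …, X_r]`. -/
structure IsReducedGroebnerBasis {K : Type*} [Field K] (ord : MonomialOrder (Fin r))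
    (I : Ideal (MvPolynomial (Fin r) K)) (B : Set (MvPolynomial (Fin r) K)) : Prop where
  subset : B ⊆ I
  exists_degree_le : ∀ f ∈ I, f ≠ 0 → ∃ g ∈ B, ord.degree g ≤ ord.degree f
  monic : ∀ g ∈ B, ord.leadingCoeff g = 1
  reduced : ∀ g ∈ B, ∀ g' ∈ B, g' ≠ g → ∀ e ∈ g.support, ¬ ord.degree g' ≤ e

/-- A Krull system of `F`-monic polynomials over a local ring `R`: a characteristic set whose
reduction modulo the maximal ideal is injective and yields a reduced Gröbner basis of the ideal
that it generates. -/
structure IsKrullSystem {R : Type*} [CommRing R] [IsLocalRing R] (ord : MonomialOrder (Fin r))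
    (F : Finset (Fin r →₀ ℕ)) (χ : Finset (MvPolynomial (Fin r) R)) : Prop where
  characteristic : IsCharacteristicSet F χ
  injOn : Set.InjOn (MvPolynomial.map (IsLocalRing.residue R)) (χ : Set (MvPolynomial (Fin r) R))
  groebner : IsReducedGroebnerBasis ord
    (Ideal.span (MvPolynomial.map (IsLocalRing.residue R) '' (χ : Set (MvPolynomial (Fin r) R))))
    (MvPolynomial.map (IsLocalRing.residue R) '' (χ : Set (MvPolynomial (Fin r) R)))

end Krull

/-! ### Canonical generating systems -/

section CGS

variable {R : Type*} [CommRing R] {r : ℕ}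

/-- The set `χ = χ_0 ∪ a^{b_1} χ_1 ∪ … ∪ a^{b_x} χ_x` (with `b_0 = 0`). -/
def unionSystem (a : R) (x : ℕ) (b : ℕ → ℕ) (χ : ℕ → Finset (MvPolynomial (Fin r) R)) :
    Set (MvPolynomial (Fin r) R) :=
  {p | ∃ m ≤ x, ∃ g ∈ χ m, p = MvPolynomial.C (a ^ b m) * g}

/-- `|F_{m-1}|`, with the convention `|F_{-1}| = n`. -/
def prevCard (n : ℕ) (F : ℕ → Finset (Fin r →₀ ℕ)) : ℕ → ℕ
  | 0 => n
  | m + 1 => (F m).card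

/-- The exponent `∑_{m=0}^{x} (t - b_m) (|F_{m-1}| - |F_m|)`, where `|F_{-1}| = n`. It is used
only where `b_m ≤ t` and `n ≥ |F_0| ≥ … ≥ |F_x|`, so that no subtraction is truncated. -/
def cardExponent (t n x : ℕ) (b : ℕ → ℕ) (F : ℕ → Finset (Fin r →₀ ℕ)) : ℕ :=
  ∑ m ∈ Finset.range (x + 1), (t - b m) * (prevCard n F m - (F m).card)

/-- The Ferrers diagrams `F_0 ⊃ … ⊃ F_x`, the numbers `0 = b_0 < … < b_x < b_{x+1} = t` and the
Krull systems `χ_0, …, χ_x` form a canonical generating system of the ideal `J` of the affine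
algebra. Only the values of `F`, `χ` at `0, …, x` and of `b` at `0, …, x + 1` matter. -/
structure IsCGS [IsLocalRing R] (ord : MonomialOrder (Fin r)) (a : R) (T : Fin r → R[X])
    (hT : ∀ j, (T j).Monic) (J : Ideal (AffineAlgebra T)) (x : ℕ)
    (F : ℕ → Finset (Fin r →₀ ℕ)) (b : ℕ → ℕ) (χ : ℕ → Finset (MvPolynomial (Fin r) R)) :
    Prop where
  ferrers : ∀ m ≤ x, IsFerrers (F m)
  subset_box : ∀ e ∈ F 0, ∀ j, e j < (T j).natDegree
  chain : ∀ m < x, F (m + 1) ⊂ F m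
  b_zero : b 0 = 0
  b_lt : ∀ m ≤ x, b m < b (m + 1)
  b_last : b (x + 1) = nilpotencyClass a
  /-- Elements of `J` supported in `F_m` have norm at least `b_{m+1}`. -/
  norm_ge : ∀ f ∈ J, ∀ m ≤ x, (rep T hT f).support ⊆ F m → b (m + 1) ≤ polyNorm a (rep T hT f)
  krull : ∀ m ≤ x, IsKrullSystem ord (F m) (χ m)
  krull_mem : ∀ m ≤ x, ∀ g ∈ χ m, toAlg T (MvPolynomial.C (a ^ b m) * g) ∈ J
  generates : Ideal.span (toAlg T '' unionSystem a x b χ) = J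
  /-- Iterated normal forms exist, and any choice of them decides membership in `J`. -/
  nf_exists : ∀ f : AffineAlgebra T, ∃ h, IsNFSequence ord a x χ (rep T hT f) h
  mem_iff : ∀ (f : AffineAlgebra T) (h : ℕ → MvPolynomial (Fin r) R),
    IsNFSequence ord a x χ (rep T hT f) h →
      (f ∈ J ↔ (∀ m ≤ x, b m ≤ polyNorm a (h m)) ∧ h (x + 1) = 0)
  card_eq : Nat.card J =
    Nat.card (IsLocalRing.ResidueField R) ^
      cardExponent (nilpotencyClass a) (∏ j, (T j).natDegree) x b F

end CGS

/-! ### Codes -/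

section Codes

variable {A : Type*} [CommRing A] {l : ℕ}

/-- The subcode of the codewords of `C` whose components before position `i` are zero. -/
def subcode (C : Submodule A (Fin l → A)) (i : Fin l) : Submodule A (Fin l → A) where
  carrier := {c | c ∈ C ∧ ∀ s < i, c s = 0}
  add_mem' := by
    rintro c d ⟨hc, hc'⟩ ⟨hd, hd'⟩
    exact ⟨C.add_mem hc hd, fun s hs => by simp [hc' s hs, hd' s hs]⟩
  zero_mem' := ⟨C.zero_mem, fun _ _ => rfl⟩
  smul_mem' := by
    rintro f c ⟨hc, hc'⟩
    exact ⟨C.smul_mem f hc, fun s hs => by simp [hc' s hs]⟩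

/-- The ideal `π_i(C_i)`: the `i`-th components of the codewords that vanish before `i`. -/
def projIdeal (C : Submodule A (Fin l → A)) (i : Fin l) : Ideal A :=
  (subcode C i).map (LinearMap.proj i)

/-- The rows of the matrix `G` generate `C` as an `A`-module. -/
def IsGeneratorMatrix {ι : Type*} (G : Matrix ι (Fin l) A) (C : Submodule A (Fin l → A)) : Prop :=
  Submodule.span A (Set.range G.row) = C

/-- The row `(0, …, 0, p, h_{i+1}, …, h_l)` with entry `p` in position `i`. -/
def rowVector (i : Fin l) (p : A) (h : Fin l → A) : Fin l → A :=
  fun z => if z < i then 0 else if z = i then p else h z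

end Codes

/-- The row indices of the generator matrix: triples `(j, m, g)` with `0 ≤ m ≤ x_j` and
`g ∈ χ_m^j`. -/
abbrev RowIndex {P : Type*} {k : ℕ} (x : Fin k → ℕ) (χ : Fin k → ℕ → Finset P) : Type _ :=
  Σ (j : Fin k) (m : Fin (x j + 1)), {g : P // g ∈ χ j m}

end ChainCode

end

open ChainCode

noncomputable section

namespace ChainCode

/-! Pull an ideal of the affine algebra back to an ideal `J` of the polynomial ring and, for each
`v`, reduce `{g | a ^ v * g ∈ J}` modulo the maximal ideal. The resulting ideals over the residue
field grow with `v`, so their sets `D v` of standard exponents are shrinking Ferrers diagrams; they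
lie in the box because the reductions of the `T j` belong to all of these ideals. The `F_m` are the
distinct values of `D v` for `v < t`, and the `b_m` are the levels where they first appear
(`exists_jumps`). Subtracting from each corner monomial a remainder supported in `F_m` yields `χ_m`,
a lift of the reduced Gröbner basis at level `b_m` (`exists_krull_polynomials`,
`isKrullSystem_of_isResidueMonic`).

The driving observation is `pow_succ_dvd_of_standard`: if `a ^ v * g` lies in `J` and has support in
`D v`, then `g` reduces to an element with only standard monomials, hence to zero, and another
factor `a` comes out. Climbing through the levels gives the norm bounds and thereby the membership
test. For the cardinality, the filtration by `J + a ^ v R[X]` has successive quotients of size `q ^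
|D v|` (`index_eq_prod_index`, `index_eq_pow`), and summation by parts turns the sum over `v` into
the sum over jumps.

A code is handled as a triangular object: nested codes with the same projection ideals coincide, and
the cardinality is the product over these ideals (`eq_of_projIdeal_le`, `card_eq_prod_projIdeal`).
Codewords that start with generators of the projection ideals therefore generate the code, and their
later entries can be normalised from left to right (`exists_mem_forall_normal`,
`exists_normal_representative`). -/

theorem card_restrictSupport {R : Type*} [CommRing R] {r : ℕ} (D : Finset (Fin r →₀ ℕ)) :
    Nat.card (MvPolynomial.restrictSupport R (D : Set (Fin r →₀ ℕ))) = Nat.card R ^ D.card := by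
  rw [Nat.card_congr
      (MvPolynomial.basisRestrictSupport R (D : Set (Fin r →₀ ℕ))).repr.toEquiv,
    Nat.card_congr Finsupp.equivFunOnFinite]
  simp [Nat.card_fun]

/-! ### Standard monomials of an ideal over a field -/

section Standard

variable {K : Type*} [Field K] {r : ℕ} (ord : MonomialOrder (Fin r))

/-- `e` is a standard exponent of the ideal `I`: it is not the degree of a nonzero element. -/
def IsStandard (I : Ideal (MvPolynomial (Fin r) K)) (e : Fin r →₀ ℕ) : Prop :=
  ∀ f ∈ I, f ≠ 0 → ord.degree f ≠ e

variable {ord}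

theorem IsStandard.mono {I I' : Ideal (MvPolynomial (Fin r) K)} (h : I ≤ I') {e : Fin r →₀ ℕ}
    (he : IsStandard ord I' e) : IsStandard ord I e :=
  fun f hf => he f (h hf)

theorem IsStandard.of_le {I : Ideal (MvPolynomial (Fin r) K)} {e e' : Fin r →₀ ℕ}
    (he : IsStandard ord I e) (hle : e' ≤ e) : IsStandard ord I e' := by
  classical
  rintro f hf hf0 rfl
  have hm : MvPolynomial.monomial (e - ord.degree f) (1 : K) ≠ 0 := by simp
  refine he (MvPolynomial.monomial (e - ord.degree f) 1 * f) (I.mul_mem_left _ hf)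
    (mul_ne_zero hm hf0) ?_
  rw [MonomialOrder.degree_mul hm hf0, MonomialOrder.degree_monomial, if_neg one_ne_zero,
    tsub_add_cancel_of_le hle]

theorem eq_zero_of_isStandard {I : Ideal (MvPolynomial (Fin r) K)} {f : MvPolynomial (Fin r) K}
    (hf : f ∈ I) (h : ∀ e ∈ f.support, IsStandard ord I e) : f = 0 := by
  by_contra h0
  exact h _ (ord.degree_mem_support h0) f hf h0 rfl

variable (ord) in
-- Division by all nonzero elements of `I` at once: an exponent of the remainder lies above none of
-- their degrees, so in particular it equals none of them.
theorem exists_standard_remainder (I : Ideal (MvPolynomial (Fin r) K))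
    (f : MvPolynomial (Fin r) K) :
    ∃ p, f - p ∈ I ∧ ∀ e ∈ p.support, IsStandard ord I e := by
  let B : {g : MvPolynomial (Fin r) K // g ∈ I ∧ g ≠ 0} → MvPolynomial (Fin r) K := Subtype.val
  have hB : ∀ i, IsUnit (ord.leadingCoeff (B i)) := fun i =>
    (ord.leadingCoeff_ne_zero_iff.mpr i.2.2).isUnit
  obtain ⟨g, p, hf, -, hp⟩ := ord.div hB f
  refine ⟨p, ?_, ?_⟩
  · rw [hf, add_sub_cancel_right, Finsupp.linearCombination_apply]
    exact Submodule.sum_mem _ fun i _ => Ideal.mul_mem_left _ _ i.2.1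
  · intro e he f' hf' hf0 hd
    exact hp e he ⟨f', hf', hf0⟩ hd.le

/-- Macaulay's basis theorem: the standard monomials represent each class of the quotient exactly
once. -/
theorem card_quotient_of_standard {I : Ideal (MvPolynomial (Fin r) K)}
    {D : Finset (Fin r →₀ ℕ)} (hD : ∀ e, e ∈ D ↔ IsStandard ord I e) :
    Nat.card (MvPolynomial (Fin r) K ⧸ I) = Nat.card K ^ D.card := by
  classical
  let S : Submodule K (MvPolynomial (Fin r) K) := MvPolynomial.restrictSupport K (D : Set _)
  have hS : ∀ p, p ∈ S ↔ ∀ e ∈ p.support, e ∈ D := fun p => by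
    simp only [S, MvPolynomial.mem_restrictSupport_iff]
    exact Iff.rfl
  rw [← card_restrictSupport]
  refine (Nat.card_eq_of_bijective (fun p : S => Ideal.Quotient.mk I p.1) ⟨?_, ?_⟩).symm
  · intro p p' h
    have h' := Ideal.Quotient.eq.mp h
    have hs : p.1 - p'.1 ∈ S := S.sub_mem p.2 p'.2
    have := eq_zero_of_isStandard (ord := ord) h' fun e he => (hD e).mp ((hS _).mp hs e he)
    exact Subtype.ext (sub_eq_zero.mp this)
  · intro f
    obtain ⟨f, rfl⟩ := Ideal.Quotient.mk_surjective f
    obtain ⟨p, hp, hp'⟩ := exists_standard_remainder ord I f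
    exact ⟨⟨p, (hS p).mpr fun e he => (hD e).mpr (hp' e he)⟩, (Ideal.Quotient.eq.mpr hp).symm⟩

theorem exists_corner_le {F : Finset (Fin r →₀ ℕ)} {e : Fin r →₀ ℕ} (he : e ∉ F) :
    ∃ s ∈ corners F, s ≤ e := by
  obtain ⟨s, hs, hm⟩ := exists_minimal_le_of_wellFoundedLT (fun e => e ∉ F) e he
  exact ⟨s, hm, hs⟩

/-- Dividing an element of `I` by the `G s` leaves a remainder in `I` with no exponent above a
corner. Its exponents are therefore all in `F`, hence standard, and it vanishes. -/
theorem span_eq_of_standard {I : Ideal (MvPolynomial (Fin r) K)} {F : Finset (Fin r →₀ ℕ)}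
    (hF : ∀ e, e ∈ F ↔ IsStandard ord I e) {G : (Fin r →₀ ℕ) → MvPolynomial (Fin r) K}
    (hG : ∀ s ∈ corners F, G s ∈ I) (hdeg : ∀ s ∈ corners F, ord.degree (G s) = s)
    (hlc : ∀ s ∈ corners F, ord.leadingCoeff (G s) = 1) :
    Ideal.span (G '' corners F) = I := by
  refine le_antisymm (Ideal.span_le.mpr ?_) fun f hf => ?_
  · rintro _ ⟨s, hs, rfl⟩
    exact hG s hs
  · have hB : ∀ i : corners F, IsUnit (ord.leadingCoeff (G i)) := fun i => by
      rw [hlc _ i.2]; exact isUnit_one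
    obtain ⟨g, p, hfp, -, hp⟩ := ord.div hB f
    have hl : f - p ∈ Ideal.span (G '' corners F) := by
      rw [hfp, add_sub_cancel_right, Finsupp.linearCombination_apply]
      exact Submodule.sum_mem _ fun i _ =>
        Ideal.mul_mem_left _ _ (Ideal.subset_span ⟨i, i.2, rfl⟩)
    have hle : Ideal.span (G '' corners F) ≤ I := Ideal.span_le.mpr (by
      rintro _ ⟨s, hs, rfl⟩
      exact hG s hs)
    have hpI : p ∈ I := by
      have := I.sub_mem hf (hle hl)
      rwa [sub_sub_cancel] at this
    have hp0 : p = 0 := by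
      refine eq_zero_of_isStandard (ord := ord) hpI fun e he => ?_
      rw [← hF]
      by_contra hn
      obtain ⟨s, hs, hse⟩ := exists_corner_le hn
      refine hp e he ⟨s, hs⟩ ?_
      rw [hdeg s hs]
      exact hse
    rwa [hp0, sub_zero] at hl

end Standard

/-! ### Jump points of a decreasing chain -/

/-- Records where `D 0, …, D t` changes. The cardinality identity is Abel summation: a drop
occurring at `b m` is counted once for every `v` from `b m` to `t`. -/
theorem exists_jumps {r : ℕ} (D : ℕ → Finset (Fin r →₀ ℕ)) (n : ℕ) (hn : ∀ v, (D v).card ≤ n)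
    (hD : Antitone D) (t : ℕ) :
    ∃ (x : ℕ) (b : ℕ → ℕ), x ≤ t ∧ b 0 = 0 ∧ (∀ m ≤ x, b m < b (m + 1)) ∧ b (x + 1) = t + 1 ∧
      (∀ m ≤ x, ∀ v, b m ≤ v → v < b (m + 1) → D v = D (b m)) ∧
      (∀ m < x, D (b (m + 1)) ⊂ D (b m)) ∧
      cardExponent (t + 1) n x b (fun m => D (b m)) =
        ∑ v ∈ Finset.range (t + 1), (n - (D v).card) := by
  have tele : ∀ (b : ℕ → ℕ) (x : ℕ), (∀ m < x, D (b (m + 1)) ⊆ D (b m)) →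
      ∑ m ∈ Finset.range (x + 1), (prevCard n (fun m => D (b m)) m - (D (b m)).card) =
        n - (D (b x)).card := by
    intro b x
    induction x with
    | zero => intro _; simp [prevCard]
    | succ x ih =>
      intro h
      rw [Finset.sum_range_succ, ih fun m hm => h m (by omega)]
      have h1 := Finset.card_le_card (h x (by omega))
      have h2 := hn (b x)
      simp only [prevCard]
      omega
  induction t with
  | zero =>
    refine ⟨0, fun m => m, le_rfl, rfl, by simp, rfl, ?_, by simp, ?_⟩
    · intro m hm v h1 h2
      have : v = m := le_antisymm (Nat.lt_succ_iff.mp h2) h1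
      rw [this]
    · simp [cardExponent, prevCard]
  | succ t ih =>
    obtain ⟨x, b, hx, b0, hb, hbx, hc, hs, he⟩ := ih
    have hmono : ∀ m ≤ x, b m < t + 1 := by
      intro m hm
      rw [← hbx]
      have : ∀ d, ∀ m, m + d = x → b m < b (x + 1) := by
        intro d
        induction d with
        | zero => intro m h; have : m = x := by omega
                  rw [this]; exact hb x le_rfl
        | succ d ih => intro m h; exact (hb m (by omega)).trans (ih (m + 1) (by omega))
      exact this (x - m) m (by omega)
    -- Raising the upper end by one increases every weight by one; the extra terms telescope to `n -
    -- |D (b x)|`.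
    have step : ∑ m ∈ Finset.range (x + 1), (t + 1 + 1 - b m) *
          (prevCard n (fun m => D (b m)) m - (D (b m)).card) =
        ∑ v ∈ Finset.range (t + 1), (n - (D v).card) + (n - (D (b x)).card) := by
      rw [← he, ← tele b x fun m hm => (hs m hm).subset, cardExponent, ← Finset.sum_add_distrib]
      refine Finset.sum_congr rfl fun m hm => ?_
      have := hmono m (by simpa [Nat.lt_succ_iff] using hm)
      rw [show t + 1 + 1 - b m = (t + 1 - b m) + 1 by omega, add_mul, one_mul]
    -- Without a change at `t + 1` only the closing breakpoint moves to `t + 2`. Otherwise the old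
    -- closing breakpoint `t + 1` becomes a genuine jump and a new one is appended.
    by_cases hDt : D (t + 1) = D (b x)
    · let b' : ℕ → ℕ := fun m => if m ≤ x then b m else t + 2
      have hb' : ∀ m ≤ x, b' m = b m := fun m hm => if_pos hm
      have hb'x : b' (x + 1) = t + 2 := if_neg (by omega)
      refine ⟨x, b', by omega, by rw [hb' 0 (Nat.zero_le _), b0], ?_, hb'x, ?_, ?_, ?_⟩
      · intro m hm
        rcases hm.lt_or_eq with h | rfl
        · rw [hb' m hm, hb' (m + 1) h]; exact hb m hm
        · rw [hb' m le_rfl, hb'x]; have := hmono m le_rfl; omega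
      · intro m hm v h1 h2
        rw [hb' m hm] at h1 ⊢
        rcases hm.lt_or_eq with h | rfl
        · rw [hb' (m + 1) h] at h2; exact hc m hm v h1 h2
        · rw [hb'x] at h2
          rcases (show v ≤ t + 1 by omega).lt_or_eq with h | rfl
          · exact hc m le_rfl v h1 (by omega)
          · exact hDt
      · intro m hm
        rw [hb' m hm.le, hb' (m + 1) hm]
        exact hs m hm
      · rw [Finset.sum_range_succ, hDt, ← step, cardExponent]
        refine Finset.sum_congr rfl fun m hm => ?_
        have hm' : m ≤ x := by simpa [Nat.lt_succ_iff] using hm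
        rw [hb' m hm']
        cases m with
        | zero => rfl
        | succ m => simp only [prevCard]; rw [hb' m (by omega)]
    · let b' : ℕ → ℕ := fun m => if m ≤ x + 1 then b m else t + 2
      have hb' : ∀ m ≤ x + 1, b' m = b m := fun m hm => if_pos hm
      have hb'x : b' (x + 2) = t + 2 := if_neg (by omega)
      have hss : D (b (x + 1)) ⊂ D (b x) := by
        rw [hbx]
        exact lt_of_le_of_ne (hD (hmono x le_rfl).le) hDt
      refine ⟨x + 1, b', by omega, by rw [hb' 0 (Nat.zero_le _), b0], ?_, hb'x, ?_, ?_, ?_⟩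
      · intro m hm
        rcases hm.lt_or_eq with h | rfl
        · rw [hb' m hm, hb' (m + 1) h]; exact hb m (by omega)
        · rw [hb' _ le_rfl, hb'x]; omega
      · intro m hm v h1 h2
        rw [hb' m hm] at h1 ⊢
        rcases hm.lt_or_eq with h | rfl
        · rw [hb' (m + 1) h] at h2; exact hc m (by omega) v h1 h2
        · rw [hb'x] at h2
          have : v = b (x + 1) := by omega
          rw [this]
      · intro m hm
        rw [hb' m hm.le, hb' (m + 1) hm]
        rcases (show m ≤ x by omega).lt_or_eq with h | rfl
        · exact hs m h
        · exact hss
      · rw [Finset.sum_range_succ, cardExponent, Finset.sum_range_succ]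
        have hlast : (t + 1 + 1 - b' (x + 1)) *
            (prevCard n (fun m => D (b' m)) (x + 1) - (D (b' (x + 1))).card) =
            (D (b x)).card - (D (t + 1)).card := by
          simp only [prevCard]
          rw [hb' _ le_rfl, hb' x (by omega), hbx]
          simp
        rw [hlast]
        have hsum : ∑ m ∈ Finset.range (x + 1), (t + 1 + 1 - b' m) *
            (prevCard n (fun m => D (b' m)) m - (D (b' m)).card) =
            ∑ v ∈ Finset.range (t + 1), (n - (D v).card) + (n - (D (b x)).card) := by
          rw [← step]
          refine Finset.sum_congr rfl fun m hm => ?_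
          have hm' : m ≤ x := by simpa [Nat.lt_succ_iff] using hm
          rw [hb' m (by omega)]
          cases m with
          | zero => rfl
          | succ m => simp only [prevCard]; rw [hb' m (by omega)]
        rw [hsum]
        have h1 := Finset.card_le_card (hD (hmono x le_rfl).le)
        have h2 := hn (b x)
        omega

/-! ### Codes and their projection ideals -/

section CodeLemmas

variable {A : Type*} [CommRing A] {l : ℕ}

theorem mem_projIdeal {C : Submodule A (Fin l → A)} {i : Fin l} {f : A} :
    f ∈ projIdeal C i ↔ ∃ c ∈ C, (∀ s < i, c s = 0) ∧ c i = f := by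
  constructor
  · rintro ⟨c, ⟨h1, h2⟩, rfl⟩
    exact ⟨c, h1, h2, rfl⟩
  · rintro ⟨c, h1, h2, rfl⟩
    exact ⟨c, ⟨h1, h2⟩, rfl⟩

/-- Gaussian elimination: the first possibly nonzero entry of a codeword of `C` is cancelled by a
codeword of `S`, leaving fewer coordinates to treat. The induction is on the number of trailing
coordinates not yet known to vanish. -/
theorem eq_of_projIdeal_le {S C : Submodule A (Fin l → A)} (h : S ≤ C)
    (hp : ∀ i, projIdeal C i ≤ projIdeal S i) : S = C := by
  refine le_antisymm h ?_
  have key : ∀ d, ∀ c ∈ C, (∀ s : Fin l, s.1 + d < l → c s = 0) → c ∈ S := by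
    intro d
    induction d with
    | zero =>
      intro c _ h0
      rw [show c = 0 from funext fun s => h0 s s.2]
      exact S.zero_mem
    | succ d ih =>
      intro c hc h0
      by_cases hd : d < l
      · let i : Fin l := ⟨l - (d + 1), by omega⟩
        have hi : i.1 = l - (d + 1) := rfl
        have hci : c i ∈ projIdeal C i := mem_projIdeal.mpr
          ⟨c, hc, fun s hs => h0 s (by have : s.1 < i.1 := hs; omega), rfl⟩
        obtain ⟨c', hc', hz, hi'⟩ := mem_projIdeal.mp (hp i hci)
        have : c - c' ∈ S := by
          refine ih _ (C.sub_mem hc (h hc')) fun s hs => ?_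
          rcases lt_or_eq_of_le (show s.1 ≤ i.1 by omega) with h | h
          · simp [hz s h, h0 s (by omega)]
          · obtain rfl : s = i := Fin.ext h
            simp [hi']
        simpa using S.add_mem this hc'
      · exact ih c hc fun s hs => absurd hs (by omega)
  intro c hc
  exact key l c hc fun s hs => absurd hs (by omega)

/-- In the filtration `V d` of codewords vanishing before `d`, the coordinate map on `V i` has image
`projIdeal C i` and kernel `V (i + 1)`. -/
theorem card_eq_prod_projIdeal (C : Submodule A (Fin l → A)) :
    Nat.card C = ∏ i, Nat.card (projIdeal C i) := by
  let V : ℕ → Submodule A (Fin l → A) := fun d =>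
    { carrier := {c | c ∈ C ∧ ∀ s : Fin l, s.1 < d → c s = 0}
      add_mem' := by
        rintro c d ⟨hc, hc'⟩ ⟨hd, hd'⟩
        exact ⟨C.add_mem hc hd, fun s hs => by simp [hc' s hs, hd' s hs]⟩
      zero_mem' := ⟨C.zero_mem, fun _ _ => rfl⟩
      smul_mem' := by
        rintro f c ⟨hc, hc'⟩
        exact ⟨C.smul_mem f hc, fun s hs => by simp [hc' s hs]⟩ }
  have hstep : ∀ i : Fin l, Nat.card (V i) = Nat.card (projIdeal C i) * Nat.card (V (i + 1)) := by
    intro i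
    let φ : V i →ₗ[A] A := (LinearMap.proj i).comp (V i).subtype
    have hr : LinearMap.range φ = projIdeal C i := by
      ext f
      rw [mem_projIdeal]
      constructor
      · rintro ⟨c, rfl⟩
        exact ⟨c.1, c.2.1, c.2.2, rfl⟩
      · rintro ⟨c, h1, h2, rfl⟩
        exact ⟨⟨c, h1, h2⟩, rfl⟩
    have hk : Nat.card (LinearMap.ker φ) = Nat.card (V (i + 1)) := by
      refine Nat.card_congr
        { toFun := fun c => ⟨c.1.1, c.1.2.1, fun s hs => ?_⟩
          invFun := fun c => ⟨⟨c.1, c.2.1, fun s hs => c.2.2 s (by omega)⟩, c.2.2 i (by omega)⟩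
          left_inv := fun _ => rfl
          right_inv := fun _ => rfl }
      rcases lt_or_eq_of_le (show s.1 ≤ i.1 by omega) with h | h
      · exact c.1.2.2 s h
      · obtain rfl : s = i := Fin.ext h
        exact c.2
    rw [Submodule.card_eq_card_quotient_mul_card (LinearMap.ker φ), hk, mul_comm,
      Nat.card_congr φ.quotKerEquivRange.toEquiv, hr, mul_comm]
  have hall : ∀ d ≤ l, Nat.card (V 0) =
      (∏ i : Fin l, if i.1 < d then Nat.card (projIdeal C i) else 1) * Nat.card (V d) := by
    intro d
    induction d with
    | zero => intro _; simp
    | succ d ih =>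
      intro hd
      rw [ih (by omega), hstep ⟨d, hd⟩, ← mul_assoc]
      congr 1
      rw [← Finset.mul_prod_erase _ _ (Finset.mem_univ (⟨d, hd⟩ : Fin l)),
        ← Finset.mul_prod_erase Finset.univ
          (fun i : Fin l => if i.1 < d + 1 then Nat.card (projIdeal C i) else 1)
          (Finset.mem_univ (⟨d, hd⟩ : Fin l))]
      simp only [lt_irrefl, if_false, one_mul, Nat.lt_succ_self, if_true]
      rw [mul_comm]
      congr 1
      refine Finset.prod_congr rfl fun i hi => ?_
      have : i.1 ≠ d := fun h => (Finset.mem_erase.mp hi).1 (Fin.ext h)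
      have h : i.1 < d ↔ i.1 < d + 1 := by omega
      simp only [h]
  have h0 : V 0 = C := by
    ext c
    exact ⟨fun h => h.1, fun h => ⟨h, fun s hs => absurd hs (by omega)⟩⟩
  have hl : Nat.card (V l) = 1 := by
    have : V l = ⊥ := by
      rw [eq_bot_iff]
      intro c hc
      exact (Submodule.mem_bot A).mpr (funext fun s => hc.2 s s.2)
    rw [this]
    simp
  have := hall l le_rfl
  rw [h0, hl, mul_one] at this
  rw [this]
  exact Finset.prod_congr rfl fun i _ => if_pos i.2

/-- A sweep from left to right: position `d` is corrected by a codeword that vanishes before `d`, so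
entries already treated are not disturbed. -/
theorem exists_mem_forall_normal {C : Submodule A (Fin l → A)} {Q : Fin l → A → Prop}
    (hQ : ∀ i f, ∃ f', Q i f' ∧ f - f' ∈ projIdeal C i) {c : Fin l → A} (hc : c ∈ C)
    (i : Fin l) : ∃ c' ∈ C, (∀ z ≤ i, c' z = c z) ∧ ∀ z, i < z → Q z (c' z) := by
  have key : ∀ d ≤ l, ∃ c' ∈ C, (∀ z ≤ i, c' z = c z) ∧ ∀ z, i < z → z.1 < d → Q z (c' z) := by
    intro d
    induction d with
    | zero => exact fun _ => ⟨c, hc, fun _ _ => rfl, fun z _ h => absurd h (by omega)⟩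
    | succ d ih =>
      intro hd
      obtain ⟨c', hc', h1, h2⟩ := ih (by omega)
      by_cases hid : i.1 < d
      · obtain ⟨f', hf', hm⟩ := hQ ⟨d, hd⟩ (c' ⟨d, hd⟩)
        obtain ⟨w, hw, hw0, hwd⟩ := mem_projIdeal.mp hm
        refine ⟨c' - w, C.sub_mem hc' hw, fun z hz => ?_, fun z hz hzd => ?_⟩
        · rw [Pi.sub_apply, hw0 z (lt_of_le_of_lt hz hid), sub_zero, h1 z hz]
        · rcases lt_or_eq_of_le (show z.1 ≤ d by omega) with h | h
          · rw [Pi.sub_apply, hw0 z h, sub_zero]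
            exact h2 z hz h
          · obtain rfl : z = ⟨d, hd⟩ := Fin.ext h
            rw [Pi.sub_apply, hwd, sub_sub_cancel]
            exact hf'
      · exact ⟨c', hc', h1, fun z hz hzd => absurd hz (by rw [Fin.lt_def]; omega)⟩
  obtain ⟨c', h1, h2, h3⟩ := key l le_rfl
  exact ⟨c', h1, h2, fun z hz => h3 z hz z.2⟩

end CodeLemmas

/-! ### The affine algebra is free on the monomials in the box -/

section Free

variable {R : Type*} [CommRing R] {r : ℕ}

/-- The exponents `e` with `e j < deg T j` for all `j`. -/
def box (T : Fin r → R[X]) : Finset (Fin r →₀ ℕ) :=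
  (Fintype.piFinset fun j => Finset.range (T j).natDegree).map
    Finsupp.equivFunOnFinite.symm.toEmbedding

theorem mem_box {T : Fin r → R[X]} {e : Fin r →₀ ℕ} :
    e ∈ box T ↔ ∀ j, e j < (T j).natDegree := by
  simp [box]

theorem card_box (T : Fin r → R[X]) : (box T).card = ∏ j, (T j).natDegree := by
  simp [box]

/-- The coordinate of a polynomial at the monomial with exponent `u`, after division by the
polynomials `T j`. -/
def boxCoord (T : Fin r → R[X]) (u : Fin r →₀ ℕ) : MvPolynomial (Fin r) R →ₗ[R] R :=
  (MvPolynomial.basisMonomials (Fin r) R).constr R fun e =>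
    ∏ j, ((Polynomial.X ^ e j : R[X]) %ₘ T j).coeff (u j)

theorem boxCoord_monomial (T : Fin r → R[X]) (u e : Fin r →₀ ℕ) (c : R) :
    boxCoord T u (MvPolynomial.monomial e c) =
      c * ∏ j, ((Polynomial.X ^ e j : R[X]) %ₘ T j).coeff (u j) := by
  have h : MvPolynomial.monomial e c = c • (MvPolynomial.basisMonomials (Fin r) R) e := by
    simp [MvPolynomial.smul_monomial]
  rw [h, map_smul, boxCoord, Module.Basis.constr_basis, smul_eq_mul]

/-- On a monomial multiple of the `i`-th generator, the factors for the other variables are common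
to all terms. What remains is a coefficient of `X ^ e i * T i` modulo `T i`, which is zero. -/
theorem boxCoord_eq_zero (T : Fin r → R[X]) (hT : ∀ j, (T j).Monic) (u : Fin r →₀ ℕ)
    {p : MvPolynomial (Fin r) R} (hp : p ∈ definingIdeal T) : boxCoord T u p = 0 := by
  classical
  have hgen : ∀ (i : Fin r) (f : MvPolynomial (Fin r) R),
      boxCoord T u (f * Polynomial.aeval (MvPolynomial.X i) (T i)) = 0 := by
    intro i f
    induction f using MvPolynomial.induction_on' with
    | add p q hp hq => rw [add_mul, map_add, hp, hq, add_zero]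
    | monomial e c =>
      have hmul : ∀ k, MvPolynomial.monomial e c *
          ((T i).coeff k • (MvPolynomial.X i : MvPolynomial (Fin r) R) ^ k) =
          MvPolynomial.monomial (e + Finsupp.single i k) (c * (T i).coeff k) := by
        intro k
        rw [MvPolynomial.X_pow_eq_monomial, MvPolynomial.smul_monomial,
          MvPolynomial.monomial_mul, smul_eq_mul, mul_one]
      have hprod : ∀ k, ∏ j, ((Polynomial.X ^ (e + Finsupp.single i k) j : R[X]) %ₘ T j).coeff
            (u j) = ((Polynomial.X ^ (e i + k) : R[X]) %ₘ T i).coeff (u i) *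
          ∏ j ∈ Finset.univ.erase i, ((Polynomial.X ^ e j : R[X]) %ₘ T j).coeff (u j) := by
        intro k
        rw [← Finset.mul_prod_erase _ _ (Finset.mem_univ i)]
        congr 1
        · simp
        · refine Finset.prod_congr rfl fun j hj => ?_
          have : i ≠ j := (Finset.ne_of_mem_erase hj).symm
          simp [this]
      have hzero : ∑ k ∈ Finset.range ((T i).natDegree + 1),
          (T i).coeff k * ((Polynomial.X ^ (e i + k) : R[X]) %ₘ T i).coeff (u i) = 0 := by
        have h1 : (Polynomial.X ^ e i * T i) %ₘ T i = 0 := Polynomial.mul_self_modByMonic (hT i)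
        have h2 : Polynomial.X ^ e i * T i = ∑ k ∈ Finset.range ((T i).natDegree + 1),
            (T i).coeff k • (Polynomial.X ^ (e i + k) : R[X]) := by
          conv_lhs => rw [(T i).as_sum_range]
          rw [Finset.mul_sum]
          refine Finset.sum_congr rfl fun k _ => ?_
          rw [← Polynomial.C_mul_X_pow_eq_monomial, Polynomial.smul_eq_C_mul, pow_add]
          ring
        have h3 := congrArg (fun p => Polynomial.coeff p (u i)) h1
        simp only [Polynomial.coeff_zero] at h3
        rw [h2, ← Polynomial.modByMonicHom_apply, map_sum, Polynomial.finsetSum_coeff] at h3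
        rw [← h3]
        refine Finset.sum_congr rfl fun k _ => ?_
        rw [map_smul, Polynomial.coeff_smul, smul_eq_mul, Polynomial.modByMonicHom_apply]
      rw [Polynomial.aeval_eq_sum_range, Finset.mul_sum, map_sum]
      simp only [hmul, boxCoord_monomial, hprod]
      calc _ = c * (∑ k ∈ Finset.range ((T i).natDegree + 1),
          (T i).coeff k * ((Polynomial.X ^ (e i + k) : R[X]) %ₘ T i).coeff (u i)) *
          ∏ j ∈ Finset.univ.erase i, ((Polynomial.X ^ e j : R[X]) %ₘ T j).coeff (u j) := by
            rw [Finset.mul_sum, Finset.sum_mul]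
            exact Finset.sum_congr rfl fun k _ => by ring
        _ = 0 := by rw [hzero, mul_zero, zero_mul]
  rw [definingIdeal] at hp
  induction hp using Submodule.span_induction with
  | mem x h =>
    obtain ⟨i, rfl⟩ := h
    simpa using hgen i 1
  | zero => exact map_zero _
  | add x y _ _ hx hy => rw [map_add, hx, hy, add_zero]
  | smul f x hx _ =>
    -- `boxCoord` is only `R`-linear, so the induction must carry the vanishing for all polynomial
    -- multiples.
    refine Submodule.span_induction (p := fun x _ => ∀ f, boxCoord T u (f • x) = 0)
      ?_ ?_ ?_ ?_ hx f
    · rintro _ ⟨i, rfl⟩ f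
      exact hgen i f
    · intro f; rw [smul_zero, map_zero]
    · intro x y _ _ hx hy f
      rw [smul_add, map_add, hx, hy, add_zero]
    · intro g x _ hx f
      rw [smul_smul]
      exact hx _

theorem boxCoord_of_isReducedPoly (T : Fin r → R[X]) (hT : ∀ j, (T j).Monic) {u : Fin r →₀ ℕ}
    {p : MvPolynomial (Fin r) R} (hp : IsReducedPoly T p) : boxCoord T u p = p.coeff u := by
  classical
  nontriviality R
  conv_lhs => rw [p.as_sum]
  rw [map_sum]
  have hterm : ∀ e ∈ p.support, boxCoord T u (MvPolynomial.monomial e (p.coeff e)) =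
      if e = u then p.coeff e else 0 := by
    intro e he
    rw [boxCoord_monomial]
    have hred : ∀ j, (Polynomial.X ^ e j : R[X]) %ₘ T j = Polynomial.X ^ e j := by
      intro j
      rw [Polynomial.modByMonic_eq_self_iff (hT j), Polynomial.degree_X_pow,
        Polynomial.degree_eq_natDegree (hT j).ne_zero]
      exact_mod_cast hp e he j
    simp only [hred, Polynomial.coeff_X_pow]
    split_ifs with h
    · subst h; simp
    · obtain ⟨j, hj⟩ := Finsupp.ne_iff.mp h
      rw [Finset.prod_eq_zero (Finset.mem_univ j) (if_neg hj.symm), mul_zero]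
  rw [Finset.sum_congr rfl hterm, Finset.sum_ite_eq' ]
  split_ifs with h
  · rfl
  · exact (MvPolynomial.notMem_support_iff.mp h).symm

theorem IsReducedPoly.sub {T : Fin r → R[X]} {p p' : MvPolynomial (Fin r) R}
    (hp : IsReducedPoly T p) (hp' : IsReducedPoly T p') : IsReducedPoly T (p - p') := by
  classical
  intro e he
  rcases Finset.mem_union.mp (MvPolynomial.support_sub _ _ _ he) with h | h
  · exact hp e h
  · exact hp' e h

/-- The functionals `boxCoord` kill the defining ideal and read off the coefficients of reduced
polynomials. This makes the chosen `rep` the unique reduced representative. -/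
theorem IsReducedPoly.eq_of_toAlg_eq {T : Fin r → R[X]} (hT : ∀ j, (T j).Monic)
    {p p' : MvPolynomial (Fin r) R} (hp : IsReducedPoly T p) (hp' : IsReducedPoly T p')
    (h : toAlg T p = toAlg T p') : p = p' := by
  rw [← sub_eq_zero]
  ext u
  rw [← boxCoord_of_isReducedPoly T hT (hp.sub hp'), boxCoord_eq_zero T hT u (Ideal.Quotient.eq.mp h)]
  rfl

theorem rep_isReducedPoly {T : Fin r → R[X]} (hT : ∀ j, (T j).Monic) (f : AffineAlgebra T) :
    IsReducedPoly T (rep T hT f) :=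
  (exists_reduced T hT f).choose_spec.1

theorem toAlg_rep {T : Fin r → R[X]} (hT : ∀ j, (T j).Monic) (f : AffineAlgebra T) :
    toAlg T (rep T hT f) = f :=
  (exists_reduced T hT f).choose_spec.2

theorem rep_toAlg {T : Fin r → R[X]} (hT : ∀ j, (T j).Monic) {p : MvPolynomial (Fin r) R}
    (hp : IsReducedPoly T p) : rep T hT (toAlg T p) = p :=
  (rep_isReducedPoly hT _).eq_of_toAlg_eq hT hp (toAlg_rep hT _)

theorem card_affineAlgebra (T : Fin r → R[X]) (hT : ∀ j, (T j).Monic) :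
    Nat.card (AffineAlgebra T) = Nat.card R ^ ∏ j, (T j).natDegree := by
  rw [← card_box, ← card_restrictSupport]
  have hS : ∀ p, p ∈ MvPolynomial.restrictSupport R (box T : Set (Fin r →₀ ℕ)) ↔
      IsReducedPoly T p := fun p => by
    rw [MvPolynomial.mem_restrictSupport_iff]
    exact forall₂_congr fun e _ => mem_box
  refine (Nat.card_eq_of_bijective
    (fun p : MvPolynomial.restrictSupport R (box T : Set (Fin r →₀ ℕ)) => toAlg T p.1)
    ⟨?_, ?_⟩).symm
  · intro p p' h
    exact Subtype.ext (((hS _).mp p.2).eq_of_toAlg_eq hT ((hS _).mp p'.2) h)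
  · intro f
    exact ⟨⟨rep T hT f, (hS _).mpr (rep_isReducedPoly hT f)⟩, toAlg_rep hT f⟩

end Free

/-! ### The index of a submodule filtered by powers of an element -/

/-- The subgroups `H v = J + a ^ v V` descend from `V` to `J`. Multiplication by `a ^ v` maps `V`
onto `H v` modulo `H (v + 1)`, and `L v` is the preimage of `H (v + 1)`, so each successive index is
that of `L v`. -/
theorem index_eq_prod_index {R V : Type*} [CommRing R] [AddCommGroup V] [Module R V] (a : R)
    (J : AddSubgroup V) (t : ℕ) (ht : a ^ t = 0) (L : ℕ → AddSubgroup V)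
    (hL : ∀ v < t, ∀ g, g ∈ L v ↔ ∃ h, a ^ v • (g - a • h) ∈ J) :
    J.index = ∏ v ∈ Finset.range t, (L v).index := by
  let μ : ℕ → V →+ V := fun v => DistribSMul.toAddMonoidHom V (a ^ v)
  let H : ℕ → AddSubgroup V := fun v => J ⊔ (μ v).range
  have hstep : ∀ v < t, (H (v + 1)).index = (L v).index * (H v).index := by
    intro v hv
    have hle : (μ (v + 1)).range ≤ (μ v).range := by
      rintro _ ⟨g, rfl⟩
      refine ⟨a • g, ?_⟩
      simp [μ, pow_succ, mul_smul]
    have hHv : H v = (μ v).range ⊔ H (v + 1) := by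
      simp only [H]
      rw [sup_left_comm, sup_eq_left.mpr hle]
    have hcomap : (H (v + 1)).comap (μ v) = L v := by
      ext g
      rw [hL v hv, AddSubgroup.mem_comap, AddSubgroup.mem_sup]
      constructor
      · rintro ⟨j, hj, _, ⟨h, rfl⟩, he⟩
        refine ⟨h, ?_⟩
        have : a ^ v • (g - a • h) = j := by
          rw [smul_sub, smul_smul, ← pow_succ]
          exact (eq_sub_of_add_eq he).symm
        rwa [this]
      · rintro ⟨h, hh⟩
        refine ⟨_, hh, _, ⟨h, rfl⟩, ?_⟩
        simp [μ, smul_sub, pow_succ, mul_smul]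
    rw [← hcomap, AddSubgroup.index_comap, ← AddSubgroup.relIndex_mul_index
      (show H (v + 1) ≤ H v from hHv ▸ le_sup_right)]
    congr 1
    rw [hHv, AddSubgroup.relIndex_sup_right]
  have hall : ∀ v ≤ t, (H v).index = ∏ w ∈ Finset.range v, (L w).index := by
    intro v
    induction v with
    | zero =>
      intro _
      have : H 0 = ⊤ := by
        rw [eq_top_iff]
        refine le_trans ?_ (le_sup_right : (μ 0).range ≤ H 0)
        intro g _
        exact ⟨g, by simp [μ]⟩
      rw [this]
      simp
    | succ v ih =>
      intro hv
      rw [hstep v hv, ih (by omega), Finset.prod_range_succ, mul_comm]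
  have : H t = J := by
    refine sup_eq_left.mpr ?_
    rintro _ ⟨g, rfl⟩
    simp [μ, ht]
  rw [← this, hall t le_rfl]

/-! ### Divisibility and norms in a chain ring -/

section ChainRing

variable {R : Type*} [CommRing R] {r : ℕ} {a : R}

theorem le_chainNorm_iff {i : ℕ} (hi : i ≤ nilpotencyClass a) {c : R} :
    i ≤ chainNorm a c ↔ a ^ i ∣ c := by
  classical
  constructor
  · intro h
    exact (pow_dvd_pow a h).trans
      (Nat.findGreatest_spec (P := fun i => a ^ i ∣ c) (Nat.zero_le _) (by simp))
  · exact fun h => Nat.le_findGreatest hi h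

theorem le_polyNorm_iff {i : ℕ} (hi : i ≤ nilpotencyClass a) {f : MvPolynomial (Fin r) R} :
    i ≤ polyNorm a f ↔ MvPolynomial.C (a ^ i) ∣ f := by
  rw [MvPolynomial.C_dvd_iff_dvd_coeff]
  constructor
  · intro h e
    exact (le_chainNorm_iff hi).mp (h.trans (ciInf_le (OrderBot.bddBelow _) e))
  · exact fun h => le_ciInf fun e => (le_chainNorm_iff hi).mpr (h e)

theorem polyNorm_le (f : MvPolynomial (Fin r) R) (e : Fin r →₀ ℕ) :
    polyNorm a f ≤ chainNorm a (f.coeff e) :=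
  ciInf_le (OrderBot.bddBelow _) e

variable [IsLocalRing R] (ha : IsLocalRing.maximalIdeal R = Ideal.span {a})
include ha

theorem residue_eq_zero_iff_dvd {c : R} : IsLocalRing.residue R c = 0 ↔ a ∣ c := by
  rw [IsLocalRing.residue_eq_zero_iff, ha, Ideal.mem_span_singleton]

theorem not_isUnit_iff_dvd {c : R} : ¬ IsUnit c ↔ a ∣ c := by
  rw [← residue_eq_zero_iff_dvd ha, ← IsLocalRing.residue_ne_zero_iff_isUnit, not_not]

theorem map_residue_eq_zero_iff {f : MvPolynomial (Fin r) R} :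
    MvPolynomial.map (IsLocalRing.residue R) f = 0 ↔ MvPolynomial.C a ∣ f := by
  rw [MvPolynomial.C_dvd_iff_dvd_coeff, MvPolynomial.ext_iff]
  refine forall_congr' fun e => ?_
  rw [MvPolynomial.coeff_map, MvPolynomial.coeff_zero, residue_eq_zero_iff_dvd ha]

theorem dvd_of_pow_mul_eq_zero {v : ℕ} (hv : v < nilpotencyClass a) {c : R}
    (h : a ^ v * c = 0) : a ∣ c := by
  rw [← not_isUnit_iff_dvd ha]
  intro hc
  have : a ^ v = 0 := by simpa [hc.mul_left_eq_zero] using h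
  exact (Nat.sInf_le (s := {k | a ^ k = 0}) this).not_gt hv

theorem dvd_of_pow_succ_dvd {v : ℕ} (hv : v < nilpotencyClass a) {c : R}
    (h : a ^ (v + 1) ∣ a ^ v * c) : a ∣ c := by
  obtain ⟨d, hd⟩ := h
  have : a ^ v * (c - a * d) = 0 := by rw [mul_sub, hd]; ring
  have := dvd_of_pow_mul_eq_zero ha hv this
  exact (dvd_sub_left (dvd_mul_right a d)).mp this

theorem chainNorm_eq_iff {v : ℕ} (hv : v < nilpotencyClass a) {c : R} :
    chainNorm a (a ^ v * c) = v ↔ IsUnit c := by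
  have h1 : v ≤ chainNorm a (a ^ v * c) := (le_chainNorm_iff hv.le).mpr (dvd_mul_right _ _)
  have h2 : v + 1 ≤ chainNorm a (a ^ v * c) ↔ a ∣ c := by
    rw [le_chainNorm_iff hv]
    refine ⟨dvd_of_pow_succ_dvd ha hv, fun h => ?_⟩
    rw [pow_succ]
    exact mul_dvd_mul_left _ h
  rw [← not_iff_not, not_isUnit_iff_dvd ha, ← h2]
  omega

/-! ### `L`-reduction by scaled monic polynomials -/

variable {ord : MonomialOrder (Fin r)}

theorem dvd_coeff_of_degree_lt {g : MvPolynomial (Fin r) R} {e : Fin r →₀ ℕ}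
    (h : ord.toSyn (ord.degree (MvPolynomial.map (IsLocalRing.residue R) g)) < ord.toSyn e) :
    a ∣ g.coeff e := by
  rw [← residue_eq_zero_iff_dvd ha, ← MvPolynomial.coeff_map]
  exact ord.coeff_eq_zero_of_lt h

/-- In `a ^ v * g` the coefficients of minimal norm are those at unit coefficients of `g`, that is,
at the support of its reduction. Hence the leading degree is the ordinary degree over the residue
field. -/
theorem isLeadingDegree_iff {v : ℕ} (hv : v < nilpotencyClass a) {g : MvPolynomial (Fin r) R}
    {s e : Fin r →₀ ℕ} (hs : g.coeff s = 1)
    (hd : ord.degree (MvPolynomial.map (IsLocalRing.residue R) g) = s) :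
    IsLeadingDegree ord a (MvPolynomial.C (a ^ v) * g) e ↔ e = s := by
  have hunit : ∀ e, chainNorm a ((MvPolynomial.C (a ^ v) * g).coeff e) = v ↔
      IsUnit (g.coeff e) := fun e => by
    rw [MvPolynomial.coeff_C_mul, chainNorm_eq_iff ha hv]
  have hsv := (hunit s).mpr (hs ▸ isUnit_one)
  have hn : polyNorm a (MvPolynomial.C (a ^ v) * g) = v :=
    le_antisymm ((polyNorm_le _ s).trans hsv.le) ((le_polyNorm_iff hv.le).mpr (dvd_mul_right _ _))
  have hle : ∀ e, IsUnit (g.coeff e) → ord.toSyn e ≤ ord.toSyn s := by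
    intro e he
    by_contra h
    rw [← hd] at h
    exact (not_isUnit_iff_dvd ha).mpr (dvd_coeff_of_degree_lt ha (not_le.mp h)) he
  simp only [IsLeadingDegree, hn, hunit]
  constructor
  · rintro ⟨h1, h2⟩
    exact ord.toSyn.injective (le_antisymm (hle e h1) (h2 s (hs ▸ isUnit_one)))
  · rintro rfl
    exact ⟨hs ▸ isUnit_one, hle⟩

theorem exists_lstep_iff {v : ℕ} (hv : v < nilpotencyClass a) {g f : MvPolynomial (Fin r) R}
    {s : Fin r →₀ ℕ} (hs : g.coeff s = 1)
    (hd : ord.degree (MvPolynomial.map (IsLocalRing.residue R) g) = s) :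
    (∃ h, LStep ord a (MvPolynomial.C (a ^ v) * g) f h) ↔
      ∃ e, s ≤ e ∧ f.coeff e ≠ 0 ∧ a ^ v ∣ f.coeff e := by
  simp only [LStep, isLeadingDegree_iff ha hv hs hd]
  constructor
  · rintro ⟨_, _, i, c, rfl, h0, h1, -⟩
    rw [h1] at h0
    refine ⟨i + _, le_add_self, h0, ?_⟩
    rw [← h1, MvPolynomial.coeff_C_mul, hs, mul_one]
    exact dvd_mul_left _ _
  · rintro ⟨e, hse, h0, c, hc⟩
    have h1 : c * (MvPolynomial.C (a ^ v) * g).coeff s = f.coeff e := by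
      rw [MvPolynomial.coeff_C_mul, hs, hc]; ring
    refine ⟨_, s, e - s, c, rfl, h1 ▸ h0, ?_, rfl⟩
    rw [h1, tsub_add_cancel_of_le hse]

/-- The polynomials `G s`, `s ∈ 𝒦F`, have coefficient `1` at `s`, and `s` is the degree of their
reduction. -/
def IsResidueMonic (ord : MonomialOrder (Fin r)) (F : Finset (Fin r →₀ ℕ))
    (G : (Fin r →₀ ℕ) → MvPolynomial (Fin r) R) : Prop :=
  ∀ s ∈ corners F, (G s).coeff s = 1 ∧
    ord.degree (MvPolynomial.map (IsLocalRing.residue R) (G s)) = s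

omit ha in
theorem notMem_of_corner_le {F : Finset (Fin r →₀ ℕ)} (hF : IsFerrers F) {s e : Fin r →₀ ℕ}
    (hs : s ∈ corners F) (h : s ≤ e) : e ∉ F :=
  fun he => hs.1 (hF h he)

variable {F : Finset (Fin r →₀ ℕ)} {G : (Fin r →₀ ℕ) → MvPolynomial (Fin r) R}

theorem isNormal_iff (hnil : 0 < nilpotencyClass a) (hF : IsFerrers F)
    (hG : IsResidueMonic ord F G) {f : MvPolynomial (Fin r) R} :
    IsNormal ord a (G '' corners F) f ↔ f.support ⊆ F := by
  have key : ∀ s ∈ corners F, (∃ h, LStep ord a (G s) f h) ↔ ∃ e, s ≤ e ∧ f.coeff e ≠ 0 := by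
    intro s hs
    have := exists_lstep_iff ha hnil (f := f) (hG s hs).1 (hG s hs).2
    simpa using this
  constructor
  · intro h e he
    by_contra hn
    obtain ⟨s, hs, hse⟩ := exists_corner_le hn
    obtain ⟨h', hh'⟩ := (key s hs).mpr ⟨e, hse, MvPolynomial.mem_support_iff.mp he⟩
    exact h ⟨h', _, ⟨s, hs, rfl⟩, hh'⟩
  · rintro h ⟨h', _, ⟨s, hs, rfl⟩, hh'⟩
    obtain ⟨e, hse, he⟩ := (key s hs).mp ⟨h', hh'⟩
    exact notMem_of_corner_le hF hs hse (h (MvPolynomial.mem_support_iff.mpr he))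

/-- The step is taken at the largest exponent outside `F` whose coefficient is not divisible by `a ^
(v + 1)`. Coefficients of `G s` above `s` are multiples of `a`, so whatever the step adds higher up
is divisible by `a ^ (v + 1)`. -/
theorem exists_lstep_lt (hnil : 0 < nilpotencyClass a) (hG : IsResidueMonic ord F G) {v : ℕ}
    {f : MvPolynomial (Fin r) R} (hf : ∀ e ∉ F, a ^ v ∣ f.coeff e)
    (hne : ∃ e ∉ F, ¬ a ^ (v + 1) ∣ f.coeff e) :
    ∃ h, (∃ g ∈ G '' corners F, LStep ord a g f h) ∧ (∀ e ∉ F, a ^ v ∣ h.coeff e) ∧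
      ∃ e ∉ F, ¬ a ^ (v + 1) ∣ f.coeff e ∧
        ∀ e' ∉ F, ¬ a ^ (v + 1) ∣ h.coeff e' → ord.toSyn e' < ord.toSyn e := by
  classical
  let S := f.support.filter fun e => e ∉ F ∧ ¬ a ^ (v + 1) ∣ f.coeff e
  have hS : ∀ e, e ∈ S ↔ e ∉ F ∧ ¬ a ^ (v + 1) ∣ f.coeff e := by
    intro e
    simp only [S, Finset.mem_filter, MvPolynomial.mem_support_iff, and_iff_right_iff_imp]
    rintro ⟨-, h⟩ h0
    exact h (h0 ▸ dvd_zero _)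
  have hSne : S.Nonempty := by
    obtain ⟨e, he⟩ := hne
    exact ⟨e, (hS e).mpr he⟩
  obtain ⟨e, heS, hmax⟩ := S.exists_max_image (fun e => ord.toSyn e) hSne
  obtain ⟨heF, hev⟩ := (hS e).mp heS
  obtain ⟨s, hs, hse⟩ := exists_corner_le heF
  obtain ⟨hs1, hsd⟩ := hG s hs
  have he0 : f.coeff e ≠ 0 := fun h0 => hev (h0 ▸ dvd_zero _)
  have hcoeff : ∀ e', (MvPolynomial.monomial (e - s) (f.coeff e) * G s).coeff e' =
      if e - s ≤ e' then f.coeff e * (G s).coeff (e' - (e - s)) else 0 :=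
    fun e' => MvPolynomial.coeff_monomial_mul' _ _ _ _
  have hlead : IsLeadingDegree ord a (G s) s := by
    simpa using (isLeadingDegree_iff ha hnil (e := s) hs1 hsd).mpr rfl
  refine ⟨f - MvPolynomial.monomial (e - s) (f.coeff e) * G s, ⟨G s, ⟨s, hs, rfl⟩, s, e - s,
    f.coeff e, hlead, ?_, ?_, rfl⟩, ?_, e, heF, hev, ?_⟩
  · rwa [hs1, mul_one]
  · rw [hs1, mul_one, tsub_add_cancel_of_le hse]
  · intro e' he'
    rw [MvPolynomial.coeff_sub, hcoeff]
    refine dvd_sub (hf e' he') ?_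
    split_ifs
    · exact (hf e heF).mul_right _
    · exact dvd_zero _
  · intro e' he' hv
    by_contra hlt
    apply hv
    rw [MvPolynomial.coeff_sub, hcoeff]
    rcases (not_lt.mp hlt).eq_or_lt with h | h
    · obtain rfl := ord.toSyn.injective h
      rw [if_pos tsub_le_self, tsub_tsub_cancel_of_le hse, hs1, mul_one, sub_self]
      exact dvd_zero _
    · refine dvd_sub ?_ ?_
      · by_contra hn
        exact (hmax e' ((hS e').mpr ⟨he', hn⟩)).not_gt h
      · split_ifs with hle
        · rw [pow_succ]
          refine mul_dvd_mul (hf e heF) (dvd_coeff_of_degree_lt ha (ord := ord) ?_)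
          rw [hsd]
          have h1 : ord.toSyn e' = ord.toSyn (e - s) + ord.toSyn (e' - (e - s)) := by
            rw [← map_add, add_tsub_cancel_of_le hle]
          have h2 : ord.toSyn e = ord.toSyn (e - s) + ord.toSyn s := by
            rw [← map_add, tsub_add_cancel_of_le hse]
          rw [h1, h2] at h
          exact lt_of_add_lt_add_left h
        · exact dvd_zero _

theorem exists_normalForm (hnil : IsNilpotent a) (hF : IsFerrers F)
    (hG : IsResidueMonic ord F G) (f : MvPolynomial (Fin r) R) :
    (NF ord a (G '' corners F) f).Nonempty := by
  have hpos : 0 < nilpotencyClass a := pos_nilpotencyClass_iff.mpr hnil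
  have key : ∀ d v, v + d = nilpotencyClass a → ∀ f : MvPolynomial (Fin r) R,
      (∀ e ∉ F, a ^ v ∣ f.coeff e) → (NF ord a (G '' corners F) f).Nonempty := by
    intro d
    induction d with
    | zero =>
      intro v hv f hf
      refine ⟨f, (isNormal_iff ha hpos hF hG).mpr fun e he => ?_, Relation.ReflTransGen.refl⟩
      by_contra hn
      have := hf e hn
      rw [show v = nilpotencyClass a from hv, pow_nilpotencyClass hnil, zero_dvd_iff] at this
      exact MvPolynomial.mem_support_iff.mp he this
    | succ d ih =>
      intro v hv
      -- Termination is lexicographic: the level `v` rises to the nilpotency index, and within a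
      -- level a strict bound on the offending exponents descends. The value `⊤` serves as the
      -- initial bound.
      have inner : ∀ δ : WithTop ord.syn, ∀ f : MvPolynomial (Fin r) R,
          (∀ e ∉ F, a ^ v ∣ f.coeff e) →
          (∀ e ∉ F, ¬ a ^ (v + 1) ∣ f.coeff e → (ord.toSyn e : WithTop ord.syn) < δ) →
          (NF ord a (G '' corners F) f).Nonempty := by
        intro δ
        induction δ using WellFoundedLT.induction with
        | ind δ ihδ =>
          intro f hf hδ
          by_cases hne : ∃ e ∉ F, ¬ a ^ (v + 1) ∣ f.coeff e
          · obtain ⟨h, hstep, hh, e, heF, hev, hlt⟩ := exists_lstep_lt ha hpos hG hf hne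
            obtain ⟨h', hn, hred⟩ := ihδ _ (hδ e heF hev) h hh
              fun e' he' hv' => WithTop.coe_lt_coe.mpr (hlt e' he' hv')
            exact ⟨h', hn, Relation.ReflTransGen.head hstep hred⟩
          · push Not at hne
            exact ih (v + 1) (by omega) f hne
      intro f hf
      exact inner ⊤ f hf fun e _ _ => WithTop.coe_lt_top _
  exact key _ 0 (Nat.zero_add _) f fun e _ => by simp

/-- The multiplier of a step is a coefficient of the current polynomial, hence divisible by `a ^ v`.
So a multiple of `a ^ v * G s`, not merely of `G s`, is subtracted. -/
theorem LReduces.dvd_and_sub_mem (hnil : 0 < nilpotencyClass a) (hG : IsResidueMonic ord F G)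
    {J : Ideal (MvPolynomial (Fin r) R)} {v : ℕ}
    (hJ : ∀ s ∈ corners F, MvPolynomial.C (a ^ v) * G s ∈ J) {f h : MvPolynomial (Fin r) R}
    (hred : LReduces ord a (G '' corners F) f h) (hf : MvPolynomial.C (a ^ v) ∣ f) :
    MvPolynomial.C (a ^ v) ∣ h ∧ f - h ∈ J := by
  induction hred with
  | refl => exact ⟨hf, by simp⟩
  | tail _ hstep ih =>
    rename_i p h _
    obtain ⟨_, ⟨s, hs, rfl⟩, e, i, c, hlead, -, hc, rfl⟩ := hstep
    have hes : e = s := by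
      refine (isLeadingDegree_iff ha hnil (ord := ord) (hG s hs).1 (hG s hs).2).mp ?_
      simpa using hlead
    rw [hes, (hG s hs).1, mul_one] at hc
    obtain ⟨c', hc'⟩ := (MvPolynomial.C_dvd_iff_dvd_coeff _ _).mp ih.1 (i + s)
    have hm : MvPolynomial.monomial i c * G s =
        MvPolynomial.monomial i c' * (MvPolynomial.C (a ^ v) * G s) := by
      rw [hc, hc', ← MvPolynomial.C_mul_monomial]
      ring
    refine ⟨?_, ?_⟩
    · rw [hm]
      exact dvd_sub ih.1 ((dvd_mul_right _ _).mul_left _)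
    · rw [hm, sub_sub_eq_add_sub, add_sub_right_comm]
      exact J.add_mem ih.2 (J.mul_mem_left _ (hJ s hs))

end ChainRing

/-! ### The residue ideals of an ideal over a chain ring -/

section ResidueIdeals

variable {R : Type*} [CommRing R] {r : ℕ}

/-- The ideal of the polynomials `g` with `a ^ v * g ∈ J`. -/
def colonPow (a : R) (J : Ideal (MvPolynomial (Fin r) R)) (v : ℕ) :
    Ideal (MvPolynomial (Fin r) R) :=
  Submodule.comap (LinearMap.mulLeft (MvPolynomial (Fin r) R) (MvPolynomial.C (a ^ v))) J

theorem mem_colonPow {a : R} {J : Ideal (MvPolynomial (Fin r) R)} {v : ℕ}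
    {g : MvPolynomial (Fin r) R} : g ∈ colonPow a J v ↔ MvPolynomial.C (a ^ v) * g ∈ J :=
  Iff.rfl

theorem colonPow_mono (a : R) (J : Ideal (MvPolynomial (Fin r) R)) : Monotone (colonPow a J) := by
  intro v w h g hg
  rw [mem_colonPow] at hg ⊢
  rw [← Nat.sub_add_cancel h, pow_add, map_mul, mul_assoc]
  exact J.mul_mem_left _ hg

variable [IsLocalRing R]

/-- The reduction modulo the maximal ideal of `colonPow a J v`. -/
def residueIdeal (a : R) (J : Ideal (MvPolynomial (Fin r) R)) (v : ℕ) :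
    Ideal (MvPolynomial (Fin r) (IsLocalRing.ResidueField R)) :=
  (colonPow a J v).map (MvPolynomial.map (IsLocalRing.residue R))

theorem map_residue_surjective :
    Function.Surjective (MvPolynomial.map (σ := Fin r) (IsLocalRing.residue R)) :=
  MvPolynomial.map_surjective _ IsLocalRing.residue_surjective

theorem mem_residueIdeal {a : R} {J : Ideal (MvPolynomial (Fin r) R)} {v : ℕ}
    {p : MvPolynomial (Fin r) (IsLocalRing.ResidueField R)} :
    p ∈ residueIdeal a J v ↔ ∃ g, MvPolynomial.C (a ^ v) * g ∈ J ∧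
      MvPolynomial.map (IsLocalRing.residue R) g = p :=
  Ideal.mem_map_iff_of_surjective _ map_residue_surjective

theorem residueIdeal_mono (a : R) (J : Ideal (MvPolynomial (Fin r) R)) :
    Monotone (residueIdeal a J) :=
  fun _ _ h => Ideal.map_mono (colonPow_mono a J h)

theorem exists_lift (p : MvPolynomial (Fin r) (IsLocalRing.ResidueField R)) :
    ∃ f : MvPolynomial (Fin r) R, MvPolynomial.map (IsLocalRing.residue R) f = p ∧
      f.support ⊆ p.support ∧ ∀ e ∈ f.support, IsUnit (f.coeff e) := by
  classical
  obtain ⟨σ, hσ⟩ := (IsLocalRing.residue_surjective (R := R)).hasRightInverse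
  let f : MvPolynomial (Fin r) R :=
    ∑ e ∈ p.support, MvPolynomial.monomial e (σ (p.coeff e))
  have hf : ∀ e, f.coeff e = if e ∈ p.support then σ (p.coeff e) else 0 := by
    intro e
    simp only [f, MvPolynomial.coeff_sum, MvPolynomial.coeff_monomial, Finset.sum_ite_eq']
  have hsupp : f.support ⊆ p.support := by
    intro e he
    by_contra hn
    exact MvPolynomial.mem_support_iff.mp he (by rw [hf, if_neg hn])
  refine ⟨f, ?_, hsupp, ?_⟩
  · ext e
    rw [MvPolynomial.coeff_map, hf]
    split_ifs with h
    · exact hσ _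
    · rw [map_zero, MvPolynomial.notMem_support_iff.mp h]
  · intro e he
    rw [← IsLocalRing.residue_ne_zero_iff_isUnit, hf, if_pos (hsupp he), hσ]
    exact MvPolynomial.mem_support_iff.mp (hsupp he)

variable {a : R} (ha : IsLocalRing.maximalIdeal R = Ideal.span {a})
  {ord : MonomialOrder (Fin r)} {J : Ideal (MvPolynomial (Fin r) R)}
include ha

theorem exists_unit_remainder (ord : MonomialOrder (Fin r))
    (J : Ideal (MvPolynomial (Fin r) R)) (v : ℕ) (g : MvPolynomial (Fin r) R) :
    ∃ i p, MvPolynomial.C (a ^ v) * i ∈ J ∧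
      (∀ e ∈ p.support, IsStandard ord (residueIdeal a J v) e ∧ IsUnit (p.coeff e)) ∧
      MvPolynomial.C a ∣ g - i - p := by
  obtain ⟨ρ, hρ, hstd⟩ := exists_standard_remainder ord (residueIdeal a J v)
    (MvPolynomial.map (IsLocalRing.residue R) g)
  obtain ⟨i, hi, hie⟩ := mem_residueIdeal.mp hρ
  obtain ⟨p, rfl, hp, hu⟩ := exists_lift ρ
  refine ⟨i, p, hi, fun e he => ⟨hstd e (hp he), hu e he⟩, ?_⟩
  rw [← map_residue_eq_zero_iff ha, map_sub, map_sub, hie]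
  ring

/-- Residue-level division applied repeatedly to the error term; after as many rounds as the
nilpotency index the error is zero. -/
theorem exists_remainder (hnil : IsNilpotent a) (v : ℕ) {F : Finset (Fin r →₀ ℕ)}
    (hF : ∀ e, e ∈ F ↔ IsStandard ord (residueIdeal a J v) e) (g : MvPolynomial (Fin r) R) :
    ∃ p, p.support ⊆ F ∧ MvPolynomial.C (a ^ v) * (g - p) ∈ J := by
  classical
  have key : ∀ k, ∃ i p h, MvPolynomial.C (a ^ v) * i ∈ J ∧ p.support ⊆ F ∧
      g = i + p + MvPolynomial.C (a ^ k) * h := by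
    intro k
    induction k with
    | zero => exact ⟨0, 0, g, by simp, by simp, by simp⟩
    | succ k ih =>
      obtain ⟨i, p, h, hi, hp, hg⟩ := ih
      obtain ⟨i', p', hi', hp', h', hh'⟩ := exists_unit_remainder ha ord J v h
      refine ⟨i + MvPolynomial.C (a ^ k) * i', p + MvPolynomial.C (a ^ k) * p', h', ?_, ?_, ?_⟩
      · rw [mul_add, mul_left_comm]
        exact J.add_mem hi (J.mul_mem_left _ hi')
      · intro e he
        rcases Finset.mem_union.mp (MvPolynomial.support_add he) with h | h
        · exact hp h
        · rw [hF]
          refine (hp' e ?_).1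
          rw [MvPolynomial.mem_support_iff, MvPolynomial.coeff_C_mul] at h
          exact MvPolynomial.mem_support_iff.mpr (right_ne_zero_of_mul h)
      · have : h = i' + p' + MvPolynomial.C a * h' := by rw [← hh']; ring
        rw [hg, this, pow_succ, map_mul]
        ring
  obtain ⟨i, p, h, hi, hp, hg⟩ := key (nilpotencyClass a)
  rw [pow_nilpotencyClass hnil, map_zero, zero_mul, add_zero] at hg
  refine ⟨p, hp, ?_⟩
  rw [hg, add_sub_cancel_right]
  exact hi

theorem pow_succ_dvd_of_standard {v : ℕ} (hv : v < nilpotencyClass a)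
    {f : MvPolynomial (Fin r) R} (hf : f ∈ J) (hdvd : MvPolynomial.C (a ^ v) ∣ f)
    (hstd : ∀ e ∈ f.support, IsStandard ord (residueIdeal a J v) e) :
    MvPolynomial.C (a ^ (v + 1)) ∣ f := by
  obtain ⟨g, rfl⟩ := hdvd
  rw [pow_succ, map_mul]
  refine mul_dvd_mul_left _ ((map_residue_eq_zero_iff ha).mp ?_)
  refine eq_zero_of_isStandard (mem_residueIdeal.mpr ⟨g, hf, rfl⟩) fun e he => hstd e ?_
  rw [MvPolynomial.mem_support_iff, MvPolynomial.coeff_map] at he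
  rw [MvPolynomial.mem_support_iff, MvPolynomial.coeff_C_mul]
  -- A unit coefficient of `g` is not killed by `a ^ v` for `v` below the nilpotency index, so the
  -- reduction of `g` has no exponent outside the support of `a ^ v * g`.
  exact fun h0 => he ((residue_eq_zero_iff_dvd ha).mpr (dvd_of_pow_mul_eq_zero ha hv h0))

/-! ### Construction of the Krull systems -/

theorem exists_krull_polynomials (hnil : IsNilpotent a) (v : ℕ) {F : Finset (Fin r →₀ ℕ)}
    (hF : ∀ e, e ∈ F ↔ IsStandard ord (residueIdeal a J v) e) :
    ∃ G : (Fin r →₀ ℕ) → MvPolynomial (Fin r) R,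
      (∀ s ∈ corners F, IsFerrersMonic F s (G s)) ∧
      (∀ s, MvPolynomial.C (a ^ v) * G s ∈ J) ∧ IsResidueMonic ord F G := by
  classical
  choose p hp hpJ using fun s : Fin r →₀ ℕ =>
    exists_remainder ha hnil v hF (MvPolynomial.monomial s (1 : R))
  refine ⟨fun s => MvPolynomial.monomial s 1 - p s, fun s hs => ⟨hs, ?_⟩, hpJ, fun s hs => ?_⟩
  · rw [sub_sub_cancel]
    exact hp s
  have hc : (MvPolynomial.monomial s 1 - p s).coeff s = 1 := by
    rw [MvPolynomial.coeff_sub, MvPolynomial.coeff_monomial, if_pos rfl,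
      MvPolynomial.notMem_support_iff.mp fun h => hs.1 (hp s h), sub_zero]
  refine ⟨hc, ?_⟩
  set g := MvPolynomial.map (IsLocalRing.residue R) (MvPolynomial.monomial s 1 - p s)
  have hg0 : g ≠ 0 := by
    intro h0
    have : g.coeff s = 1 := by rw [MvPolynomial.coeff_map, hc, map_one]
    rw [h0] at this
    exact zero_ne_one this
  -- The degree of a nonzero element of the residue ideal is not standard, so among `s` and the
  -- exponents in `F` it can only be `s`.
  have hdF : ord.degree g ∉ F := by
    rw [hF]
    exact fun h => h g (mem_residueIdeal.mpr ⟨_, hpJ s, rfl⟩) hg0 rfl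
  have hmem := MvPolynomial.support_map_subset _ _ (ord.degree_mem_support hg0)
  rcases Finset.mem_union.mp (MvPolynomial.support_sub _ _ _ hmem) with h | h
  · exact Finset.mem_singleton.mp (MvPolynomial.support_monomial_subset h)
  · exact absurd (hp s h) hdF

omit ha in
theorem finite_corners (F : Finset (Fin r →₀ ℕ)) : (corners F).Finite :=
  (setOfPred_minimal_antichain _).finite_of_partiallyWellOrderedOn
    (Set.isPWO_of_wellQuasiOrderedLE _)

omit ha in
-- Distinct corners are distinct degrees, which gives injectivity. The basis is reduced because
-- corners form an antichain and all other exponents lie in `F`, where nothing is above a corner.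
theorem isKrullSystem_of_isResidueMonic {v : ℕ} {F : Finset (Fin r →₀ ℕ)}
    (hF : ∀ e, e ∈ F ↔ IsStandard ord (residueIdeal a J v) e)
    {G : (Fin r →₀ ℕ) → MvPolynomial (Fin r) R}
    (hfm : ∀ s ∈ corners F, IsFerrersMonic F s (G s))
    (hJ : ∀ s, MvPolynomial.C (a ^ v) * G s ∈ J) (hG : IsResidueMonic ord F G)
    {χ : Finset (MvPolynomial (Fin r) R)} (hχ : (χ : Set _) = G '' corners F) :
    IsKrullSystem ord F χ ∧
      Ideal.span (MvPolynomial.map (IsLocalRing.residue R) ''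
        (χ : Set (MvPolynomial (Fin r) R))) = residueIdeal a J v := by
  classical
  have hlc : ∀ s ∈ corners F,
      ord.leadingCoeff (MvPolynomial.map (IsLocalRing.residue R) (G s)) = 1 := by
    intro s hs
    rw [MonomialOrder.leadingCoeff, (hG s hs).2, MvPolynomial.coeff_map, (hG s hs).1, map_one]
  have hspan : Ideal.span (MvPolynomial.map (IsLocalRing.residue R) ''
      (χ : Set (MvPolynomial (Fin r) R))) = residueIdeal a J v := by
    rw [hχ, Set.image_image]
    exact span_eq_of_standard hF (fun s _ => mem_residueIdeal.mpr ⟨_, hJ s, rfl⟩)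
      (fun s hs => (hG s hs).2) hlc
  refine ⟨⟨⟨G, hfm, hχ⟩, ?_, ?_⟩, hspan⟩
  · rw [hχ]
    rintro _ ⟨s, hs, rfl⟩ _ ⟨s', hs', rfl⟩ h
    have := congrArg ord.degree h
    rw [(hG s hs).2, (hG s' hs').2] at this
    rw [this]
  · refine ⟨Ideal.subset_span, ?_, ?_, ?_⟩
    · intro f hf hf0
      rw [hspan] at hf
      have hd : ord.degree f ∉ F := by
        rw [hF]
        exact fun h => h f hf hf0 rfl
      obtain ⟨s, hs, hle⟩ := exists_corner_le hd
      refine ⟨_, ⟨G s, hχ ▸ ⟨s, hs, rfl⟩, rfl⟩, ?_⟩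
      rw [(hG s hs).2]
      exact hle
    · rw [hχ]
      rintro _ ⟨_, ⟨s, hs, rfl⟩, rfl⟩
      exact hlc s hs
    · rw [hχ]
      rintro _ ⟨_, ⟨s, hs, rfl⟩, rfl⟩ _ ⟨_, ⟨s', hs', rfl⟩, rfl⟩ hne e he hle
      rw [(hG s' hs').2] at hle
      have hmem := MvPolynomial.support_map_subset _ _ he
      have hsub : G s = MvPolynomial.monomial s 1 - (MvPolynomial.monomial s 1 - G s) := by
        rw [sub_sub_cancel]
      rw [hsub] at hmem
      rcases Finset.mem_union.mp (MvPolynomial.support_sub _ _ _ hmem) with h | h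
      · obtain rfl := Finset.mem_singleton.mp (MvPolynomial.support_monomial_subset h)
        exact hne (by rw [le_antisymm hle (hs.2 hs'.1 hle)])
      · have heF := (hfm s hs).2 h
        rw [hF] at heF
        exact hs'.1 ((hF _).mpr (heF.of_le hle))

/-! ### Cardinalities -/

theorem index_eq_pow (hnil : IsNilpotent a) {D : ℕ → Finset (Fin r →₀ ℕ)}
    (hD : ∀ v e, e ∈ D v ↔ IsStandard ord (residueIdeal a J v) e) :
    (Submodule.toAddSubgroup J).index = Nat.card (IsLocalRing.ResidueField R) ^
      ∑ v ∈ Finset.range (nilpotencyClass a), (D v).card := by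
  rw [index_eq_prod_index a (Submodule.toAddSubgroup J) _ (pow_nilpotencyClass hnil)
    (fun v => (Submodule.toAddSubgroup (residueIdeal a J v)).comap
      (MvPolynomial.map (IsLocalRing.residue R)).toAddMonoidHom),
    ← Finset.prod_pow_eq_pow_sum]
  · refine Finset.prod_congr rfl fun v _ => ?_
    rw [AddSubgroup.index_comap_of_surjective _ map_residue_surjective,
      ← card_quotient_of_standard (hD v)]
    rfl
  · intro v _ g
    rw [AddSubgroup.mem_comap]
    change MvPolynomial.map (IsLocalRing.residue R) g ∈ residueIdeal a J v ↔
      ∃ h, a ^ v • (g - a • h) ∈ J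
    rw [mem_residueIdeal]
    constructor
    · rintro ⟨g', hg', he⟩
      rw [eq_comm, ← sub_eq_zero, ← map_sub, map_residue_eq_zero_iff ha] at he
      obtain ⟨h, hh⟩ := he
      refine ⟨h, ?_⟩
      rw [MvPolynomial.smul_eq_C_mul, MvPolynomial.smul_eq_C_mul, ← hh, sub_sub_cancel]
      exact hg'
    · rintro ⟨h, hh⟩
      rw [MvPolynomial.smul_eq_C_mul] at hh
      refine ⟨_, hh, ?_⟩
      rw [map_sub, sub_eq_self, map_residue_eq_zero_iff ha, MvPolynomial.smul_eq_C_mul]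
      exact dvd_mul_right _ _

theorem card_eq_pow_nilpotencyClass (hnil : IsNilpotent a) :
    Nat.card R = Nat.card (IsLocalRing.ResidueField R) ^ nilpotencyClass a := by
  rw [← AddSubgroup.index_bot (G := R), index_eq_prod_index a (⊥ : AddSubgroup R) _
    (pow_nilpotencyClass hnil)
    (fun _ => Submodule.toAddSubgroup (IsLocalRing.maximalIdeal R))]
  · rw [Finset.prod_const, Finset.card_range]
    rfl
  · intro v hv g
    change g ∈ IsLocalRing.maximalIdeal R ↔ _
    rw [ha, Ideal.mem_span_singleton]
    constructor
    · rintro ⟨h, rfl⟩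
      exact ⟨h, by simp⟩
    · rintro ⟨h, hh⟩
      have := dvd_of_pow_mul_eq_zero ha hv (AddSubgroup.mem_bot.mp hh)
      exact (dvd_sub_left (dvd_mul_right a h)).mp this

/-! ### Polynomials that are normal at every level -/

/-- The representative is built as a sum of layers `a ^ k * p_k`, where `p_k` has unit coefficients
supported in `D k`. Normality is thus obtained for all levels together, whereas successive normal
forms treat one `χ m` at a time. -/
theorem exists_normal_representative (hnil : IsNilpotent a) {D : ℕ → Finset (Fin r →₀ ℕ)}
    (hD : ∀ v e, e ∈ D v ↔ IsStandard ord (residueIdeal a J v) e)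
    (f : MvPolynomial (Fin r) R) :
    ∃ p, f - p ∈ J ∧
      ∀ v < nilpotencyClass a, ∀ e, p.coeff e ≠ 0 → a ^ v ∣ p.coeff e → e ∈ D v := by
  have key : ∀ d k, k + d = nilpotencyClass a → ∀ f : MvPolynomial (Fin r) R,
      MvPolynomial.C (a ^ k) ∣ f → ∃ p, MvPolynomial.C (a ^ k) ∣ p ∧ f - p ∈ J ∧
      ∀ v < nilpotencyClass a, ∀ e, p.coeff e ≠ 0 → a ^ v ∣ p.coeff e → e ∈ D v := by
    intro d
    induction d with
    | zero =>
      intro k hk f hf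
      rw [show k = nilpotencyClass a from hk, pow_nilpotencyClass hnil, map_zero,
        zero_dvd_iff] at hf
      exact ⟨0, dvd_zero _, by simp [hf], by simp⟩
    | succ d ih =>
      rintro k hk _ ⟨g, rfl⟩
      obtain ⟨i, p, hi, hp, h, hh⟩ := exists_unit_remainder ha ord J k g
      obtain ⟨p', hp'd, hp'J, hp'⟩ := ih (k + 1) (by omega) (MvPolynomial.C (a ^ (k + 1)) * h)
        (dvd_mul_right _ _)
      refine ⟨MvPolynomial.C (a ^ k) * p + p', dvd_add (dvd_mul_right _ _)
        (Dvd.dvd.trans (map_dvd _ (pow_dvd_pow a k.le_succ)) hp'd), ?_, ?_⟩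
      · have : MvPolynomial.C (a ^ k) * g - (MvPolynomial.C (a ^ k) * p + p') =
            MvPolynomial.C (a ^ k) * i + (MvPolynomial.C (a ^ (k + 1)) * h - p') := by
          rw [pow_succ, map_mul, mul_assoc, ← hh]
          ring
        rw [this]
        exact J.add_mem hi hp'J
      · intro v hv e he hve
        rw [MvPolynomial.coeff_add, MvPolynomial.coeff_C_mul] at he hve
        have hd' := (MvPolynomial.C_dvd_iff_dvd_coeff _ _).mp hp'd e
        by_cases hep : e ∈ p.support
        · obtain ⟨hstd, hu⟩ := hp e hep
          -- Later layers are divisible by `a ^ (k + 1)`, so the unit in layer `k` fixes the norm at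
          -- `e` as `k`; then `D k ⊆ D v` finishes the case.
          have hvk : v ≤ k := by
            by_contra hlt
            have h1 : a ^ (k + 1) ∣ a ^ k * p.coeff e :=
              (dvd_add_left hd').mp ((pow_dvd_pow a (not_le.mp hlt)).trans hve)
            exact (not_isUnit_iff_dvd ha).mpr (dvd_of_pow_succ_dvd ha (by omega) h1) hu
          rw [hD]
          exact hstd.mono (residueIdeal_mono a J hvk)
        · rw [MvPolynomial.notMem_support_iff.mp hep, mul_zero, zero_add] at he hve
          exact hp' v hv e he hve
  obtain ⟨p, -, h⟩ := key _ 0 (Nat.zero_add _) f (by simp)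
  exact ⟨p, h⟩

end ResidueIdeals

/-! ### Existence of canonical generating systems -/

section Existence

variable {R : Type*} [CommRing R] {r : ℕ}

theorem degree_aeval_X [Nontrivial R] (ord : MonomialOrder (Fin r)) (i : Fin r) {p : R[X]}
    (hp : p.Monic) :
    ord.degree (Polynomial.aeval (MvPolynomial.X i : MvPolynomial (Fin r) R) p) =
      Finsupp.single i p.natDegree := by
  apply ord.toSyn.injective
  apply le_antisymm
  · rw [ord.degree_le_iff]
    intro e he
    rw [MvPolynomial.mem_support_iff, coeff_aeval_X] at he
    obtain ⟨k, hk, hke⟩ := Finset.exists_ne_zero_of_sum_ne_zero he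
    have hek : Finsupp.single i k = e := by
      by_contra h
      simp [h] at hke
    rw [← hek]
    apply ord.toSyn_monotone
    exact Finsupp.single_mono (Nat.lt_succ_iff.mp (Finset.mem_range.mp hk))
  · apply ord.le_degree
    rw [MvPolynomial.mem_support_iff, coeff_aeval_X, Finset.sum_eq_single p.natDegree]
    · rw [if_pos rfl, hp.coeff_natDegree]
      exact one_ne_zero
    · intro k _ hk
      rw [if_neg]
      exact fun h => hk (Finsupp.single_injective i h)
    · simp

/-- The monic `T j` reduces to an element of the residue ideal of degree `n_j` in the variable `j`,
so no standard exponent reaches `n_j` there. -/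
theorem mem_box_of_isStandard [IsLocalRing R] {ord : MonomialOrder (Fin r)} {a : R}
    {T : Fin r → R[X]} (hT : ∀ j, (T j).Monic) {J : Ideal (MvPolynomial (Fin r) R)}
    (hJ : definingIdeal T ≤ J) {v : ℕ} {e : Fin r →₀ ℕ}
    (he : IsStandard ord (residueIdeal a J v) e) : e ∈ box T := by
  rw [mem_box]
  intro j
  by_contra hj
  have hm := (hT j).map (IsLocalRing.residue R)
  have hmap : MvPolynomial.map (IsLocalRing.residue R)
      (Polynomial.aeval (MvPolynomial.X j : MvPolynomial (Fin r) R) (T j)) =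
      Polynomial.aeval (MvPolynomial.X j) ((T j).map (IsLocalRing.residue R)) := by
    rw [Polynomial.aeval_def, Polynomial.aeval_def, Polynomial.hom_eval₂, Polynomial.eval₂_map,
      MvPolynomial.map_X]
    congr 1
    ext c
    simp [MvPolynomial.algebraMap_eq]
  have hd := degree_aeval_X ord j hm
  rw [← hmap, (hT j).natDegree_map] at hd
  refine he.of_le (Finsupp.single_le_iff.mpr (not_lt.mp hj)) _
    (mem_residueIdeal.mpr ⟨_, J.mul_mem_left _ (hJ (Ideal.subset_span ⟨j, rfl⟩)), rfl⟩) ?_ hd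
  rw [hmap, ← ord.leadingCoeff_ne_zero_iff, MonomialOrder.leadingCoeff, ← hmap, hd,
    MvPolynomial.coeff_map, coeff_aeval_X, Finset.sum_eq_single (T j).natDegree]
  · rw [if_pos rfl, (hT j).coeff_natDegree, map_one]
    exact one_ne_zero
  · intro k _ hk
    rw [if_neg]
    exact fun h => hk (Finsupp.single_injective j h)
  · simp

theorem exists_between_jumps {b : ℕ → ℕ} (h0 : b 0 = 0) {x k : ℕ} (hk : k < b (x + 1)) :
    ∃ m ≤ x, b m ≤ k ∧ k < b (m + 1) := by
  induction x with
  | zero => exact ⟨0, le_rfl, by omega, hk⟩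
  | succ x ih =>
    by_cases h : k < b (x + 1)
    · obtain ⟨m, hm, h'⟩ := ih h
      exact ⟨m, by omega, h'⟩
    · exact ⟨x + 1, le_rfl, by omega, hk⟩

theorem card_ideal_eq_pow [IsLocalRing R] [Finite R] {a : R}
    (ha : IsLocalRing.maximalIdeal R = Ideal.span {a}) (hnil : IsNilpotent a)
    {ord : MonomialOrder (Fin r)} {T : Fin r → R[X]} (hT : ∀ j, (T j).Monic)
    (J : Ideal (AffineAlgebra T)) {D : ℕ → Finset (Fin r →₀ ℕ)}
    (hD : ∀ v e, e ∈ D v ↔ IsStandard ord (residueIdeal a (J.comap (toAlg T)) v) e)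
    (hcard : ∀ v, (D v).card ≤ ∏ j, (T j).natDegree) :
    Nat.card J = Nat.card (IsLocalRing.ResidueField R) ^
      ∑ v ∈ Finset.range (nilpotencyClass a), (∏ j, (T j).natDegree - (D v).card) := by
  have hq : 0 < Nat.card (IsLocalRing.ResidueField R) := by
    have : Finite (IsLocalRing.ResidueField R) :=
      Finite.of_surjective _ (IsLocalRing.residue_surjective (R := R))
    exact Nat.card_pos
  have h1 : Nat.card J * (Submodule.toAddSubgroup J).index = Nat.card (AffineAlgebra T) :=
    (Submodule.toAddSubgroup J).card_mul_index
  have h2 : (Submodule.toAddSubgroup J).index =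
      (Submodule.toAddSubgroup (J.comap (toAlg T))).index :=
    (AddSubgroup.index_comap_of_surjective (Submodule.toAddSubgroup J)
      (f := (toAlg T).toAddMonoidHom) Ideal.Quotient.mk_surjective).symm
  rw [h2, index_eq_pow ha hnil hD, card_affineAlgebra T hT, card_eq_pow_nilpotencyClass ha hnil,
    ← pow_mul] at h1
  refine Nat.eq_of_mul_eq_mul_right (pow_pos hq _) (h1.trans ?_)
  rw [← pow_add, ← Finset.sum_add_distrib]
  congr 1
  rw [Finset.sum_congr rfl fun v _ => Nat.sub_add_cancel (hcard v), Finset.sum_const,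
    Finset.card_range, smul_eq_mul]

/-- The final clause, representatives normal modulo the whole union, is what normalises the later
entries of the generator matrix. -/
theorem exists_isCGS [IsLocalRing R] [Finite R] {a : R}
    (ha : IsLocalRing.maximalIdeal R = Ideal.span {a}) (hnil : IsNilpotent a)
    (ord : MonomialOrder (Fin r)) (T : Fin r → R[X]) (hT : ∀ j, (T j).Monic)
    (J : Ideal (AffineAlgebra T)) :
    ∃ (x : ℕ) (F : ℕ → Finset (Fin r →₀ ℕ)) (b : ℕ → ℕ)
      (χ : ℕ → Finset (MvPolynomial (Fin r) R)),
      x ≤ nilpotencyClass a - 1 ∧ IsCGS ord a T hT J x F b χ ∧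
      ∀ f : AffineAlgebra T, ∃ f',
        IsNormal ord a (unionSystem a x b χ) (rep T hT f') ∧ f - f' ∈ J := by
  classical
  set t := nilpotencyClass a with ht
  have hpos : 0 < t := pos_nilpotencyClass_iff.mpr hnil
  set J' := J.comap (toAlg T) with hJ'
  have hTJ : definingIdeal T ≤ J' := by
    intro p hp
    rw [hJ', Ideal.mem_comap, Ideal.Quotient.eq_zero_iff_mem.mpr hp]
    exact J.zero_mem
  let D : ℕ → Finset (Fin r →₀ ℕ) := fun v =>
    (box T).filter fun e => IsStandard ord (residueIdeal a J' v) e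
  have hD : ∀ v e, e ∈ D v ↔ IsStandard ord (residueIdeal a J' v) e := by
    intro v e
    simp only [D, Finset.mem_filter, and_iff_right_iff_imp]
    exact mem_box_of_isStandard hT hTJ
  have hDbox : ∀ v, D v ⊆ box T := fun v => Finset.filter_subset _ _
  have hDcard : ∀ v, (D v).card ≤ ∏ j, (T j).natDegree := fun v =>
    card_box T ▸ Finset.card_le_card (hDbox v)
  have hDanti : Antitone D := fun v w h e he =>
    (hD v e).mpr (((hD w e).mp he).mono (residueIdeal_mono a J' h))
  have hDfer : ∀ v, IsFerrers (D v) := fun v e e' hle he =>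
    (hD v e').mpr (((hD v e).mp he).of_le hle)
  -- The levels that matter are `0, …, t - 1`, so the closing breakpoint is `t`.
  obtain ⟨x, b, hx, b0, hb, hbx, hconst, hss, hexp⟩ := exists_jumps D _ hDcard hDanti (t - 1)
  rw [Nat.sub_add_cancel hpos] at hbx hexp
  have hblt : ∀ m ≤ x, b (m + 1) ≤ t := by
    have : ∀ d m, m + d = x → b (m + 1) ≤ t := by
      intro d
      induction d with
      | zero => rintro m rfl; exact hbx.le
      | succ d ih => intro m h; exact (hb (m + 1) (by omega)).le.trans (ih (m + 1) (by omega))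
    exact fun m hm => this (x - m) m (by omega)
  have hbt : ∀ m ≤ x, b m < t := fun m hm => (hb m hm).trans_le (hblt m hm)
  choose G hGf hGJ hGm using fun v => exists_krull_polynomials (J := J') ha hnil v (hD v)
  let χ : ℕ → Finset (MvPolynomial (Fin r) R) := fun m =>
    ((finite_corners (D (b m))).image (G (b m))).toFinset
  have hχ : ∀ m, (χ m : Set _) = G (b m) '' corners (D (b m)) := fun m => by simp [χ]
  have hK := fun m => isKrullSystem_of_isResidueMonic (hD (b m)) (hGf (b m)) (hGJ (b m))
    (hGm (b m)) (hχ m)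
  have hχmem : ∀ m g, g ∈ χ m → MvPolynomial.C (a ^ b m) * g ∈ J' := by
    intro m g hg
    rw [← Finset.mem_coe, hχ] at hg
    obtain ⟨s, -, rfl⟩ := hg
    exact hGJ _ s
  -- elements of the ideal supported in `D (b m)` are divisible by `a ^ b (m + 1)`
  have hnorm : ∀ f ∈ J', ∀ m ≤ x, f.support ⊆ D (b m) → MvPolynomial.C (a ^ b (m + 1)) ∣ f := by
    intro f hf m hm hsupp
    have : ∀ w ≤ b (m + 1), MvPolynomial.C (a ^ w) ∣ f := by
      intro w
      induction w with
      | zero => intro _; simp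
      | succ w ih =>
        intro hw
        refine pow_succ_dvd_of_standard ha (hw.trans (hblt m hm)) hf (ih (by omega))
          (ord := ord) fun e he => (hD w e).mp ?_
        rcases le_total w (b m) with h | h
        · exact hDanti h (hsupp he)
        · rw [hconst m hm w h hw]
          exact hsupp he
    exact this _ le_rfl
  have hrepJ : ∀ f, f ∈ J ↔ rep T hT f ∈ J' := fun f => by
    rw [hJ', Ideal.mem_comap, toAlg_rep]
  have hgen : Ideal.span (toAlg T '' unionSystem a x b χ) = J := by
    refine le_antisymm (Ideal.span_le.mpr ?_) ?_
    · rintro _ ⟨_, ⟨m, -, g, hg, rfl⟩, rfl⟩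
      exact hχmem m g hg
    set S := (Ideal.span (toAlg T '' unionSystem a x b χ)).comap (toAlg T)
    have hSle : ∀ m ≤ x, Ideal.span (χ m : Set (MvPolynomial (Fin r) R)) ≤
        colonPow a S (b m) := fun m hm => Ideal.span_le.mpr fun g hg =>
      Ideal.subset_span ⟨_, ⟨m, hm, g, hg, rfl⟩, rfl⟩
    have hJle : ∀ m ≤ x, Ideal.span (χ m : Set (MvPolynomial (Fin r) R)) ≤
        colonPow a J' (b m) := fun m hm => Ideal.span_le.mpr fun g hg => hχmem m g hg
    have key : ∀ d k, k + d = t → ∀ f ∈ J', MvPolynomial.C (a ^ k) ∣ f → f ∈ S := by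
      intro d
      induction d with
      | zero =>
        intro k hk f _ hf
        rw [show k = nilpotencyClass a from hk, pow_nilpotencyClass hnil, map_zero,
          zero_dvd_iff] at hf
        rw [hf]
        exact S.zero_mem
      | succ d ih =>
        rintro k hk _ hf ⟨g, rfl⟩
        obtain ⟨m, hm, h1, h2⟩ := exists_between_jumps b0 (show k < b (x + 1) by omega)
        -- The residue ideals at levels `b m` and `k` are nested with the same standard exponents,
        -- so they coincide: generators are needed only at jumps.
        have hg : MvPolynomial.map (IsLocalRing.residue R) g ∈ residueIdeal a J' (b m) := by
          obtain ⟨p, hp, hpstd⟩ := exists_standard_remainder ord (residueIdeal a J' (b m))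
            (MvPolynomial.map (IsLocalRing.residue R) g)
          have hgk : MvPolynomial.map (IsLocalRing.residue R) g ∈ residueIdeal a J' k :=
            mem_residueIdeal.mpr ⟨g, hf, rfl⟩
          have hpk : p ∈ residueIdeal a J' k := by
            have := Ideal.sub_mem _ hgk (residueIdeal_mono a J' h1 hp)
            rwa [sub_sub_cancel] at this
          have hp0 : p = 0 := eq_zero_of_isStandard (ord := ord) hpk fun e he => by
            rw [← hD, hconst m hm k h1 h2, hD]
            exact hpstd e he
          rwa [hp0, sub_zero] at hp
        rw [← (hK m).2, ← Ideal.map_span,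
          Ideal.mem_map_iff_of_surjective _ map_residue_surjective] at hg
        obtain ⟨g', hg', he⟩ := hg
        have hS : MvPolynomial.C (a ^ k) * g' ∈ S := colonPow_mono a S h1 (hSle m hm hg')
        have hJk : MvPolynomial.C (a ^ k) * g' ∈ J' := colonPow_mono a J' h1 (hJle m hm hg')
        have hdiff : MvPolynomial.C (a ^ k) * g - MvPolynomial.C (a ^ k) * g' ∈ S := by
          refine ih (k + 1) (by omega) _ (J'.sub_mem hf hJk) ?_
          rw [← mul_sub, pow_succ, map_mul]
          refine mul_dvd_mul_left _ ((map_residue_eq_zero_iff ha).mp ?_)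
          rw [map_sub, he, sub_self]
        simpa using S.add_mem hdiff hS
    intro f hf
    have := key t 0 (Nat.zero_add _) _ ((hrepJ f).mp hf) (by simp)
    rwa [Ideal.mem_comap, toAlg_rep] at this
  have hNF : ∀ m f, (NF ord a (χ m : Set (MvPolynomial (Fin r) R)) f).Nonempty := by
    intro m f
    rw [hχ]
    exact exists_normalForm ha hnil (hDfer _) (hGm _) f
  refine ⟨x, fun m => D (b m), b, χ, hx, ?_, ?_⟩
  · refine ⟨fun m _ => hDfer _, fun e he => mem_box.mp (hDbox _ he), hss, b0, hb, hbx, ?_,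
      fun m _ => (hK m).1, fun m _ g hg => hχmem m g hg, hgen, ?_, ?_, ?_⟩
    · intro f hf m hm hsupp
      exact (le_polyNorm_iff (hblt m hm)).mpr (hnorm _ ((hrepJ f).mp hf) m hm hsupp)
    · intro f
      choose N hN using hNF
      exact ⟨fun m => Nat.rec (rep T hT f) (fun m p => N m p) m, rfl, fun m _ => hN m _⟩
    · rintro f h ⟨h0, hh⟩
      have hstep : ∀ m ≤ x, MvPolynomial.C (a ^ b m) ∣ h m → h m - h (m + 1) ∈ J' := by
        intro m hm hdvd
        have hred := (hh m hm).2
        rw [hχ] at hred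
        exact (LReduces.dvd_and_sub_mem ha hpos (hGm _) (fun s _ => hGJ _ s) hred hdvd).2
      have hsupp : ∀ m ≤ x, (h (m + 1)).support ⊆ D (b m) := by
        intro m hm
        have hn := (hh m hm).1
        rw [hχ] at hn
        exact (isNormal_iff ha hpos (hDfer _) (hGm _)).mp hn
      rw [hrepJ, ← h0]
      constructor
      · intro hf
        have key : ∀ m ≤ x + 1, h m ∈ J' ∧ MvPolynomial.C (a ^ b m) ∣ h m := by
          intro m
          induction m with
          | zero => exact fun _ => ⟨hf, by simp [b0]⟩
          | succ m ih =>
            intro hm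
            obtain ⟨h1, h2⟩ := ih (by omega)
            have h3 : h (m + 1) ∈ J' := by
              have := J'.sub_mem h1 (hstep m (by omega) h2)
              rwa [sub_sub_cancel] at this
            exact ⟨h3, hnorm _ h3 m (by omega) (hsupp m (by omega))⟩
        refine ⟨fun m hm => (le_polyNorm_iff (hbt m hm).le).mpr (key m (by omega)).2, ?_⟩
        have := (key (x + 1) le_rfl).2
        rwa [hbx, pow_nilpotencyClass hnil, map_zero, zero_dvd_iff] at this
      · rintro ⟨h1, h2⟩
        have key : ∀ m ≤ x + 1, h 0 - h m ∈ J' := by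
          intro m
          induction m with
          | zero => intro _; simp
          | succ m ih =>
            intro hm
            have := J'.add_mem (ih (by omega)) (hstep m (by omega)
              ((le_polyNorm_iff (hbt m (by omega)).le).mp (h1 m (by omega))))
            rwa [sub_add_sub_cancel] at this
        have := key (x + 1) le_rfl
        rwa [h2, sub_zero] at this
    · rw [hexp]
      exact card_ideal_eq_pow ha hnil hT J hD hDcard
  · intro f
    obtain ⟨p, hpJ, hp⟩ := exists_normal_representative ha hnil hD (rep T hT f)
    -- At level `0` the divisibility condition is empty, so the whole support lies in `D 0`, inside
    -- the box.
    have hred : IsReducedPoly T p := fun e he => mem_box.mp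
      (hDbox 0 (hp 0 hpos e (MvPolynomial.mem_support_iff.mp he) (by simp)))
    refine ⟨toAlg T p, ?_, ?_⟩
    · rw [rep_toAlg hT hred]
      rintro ⟨h', _, ⟨m, hm, g, hg, rfl⟩, hstep⟩
      rw [← Finset.mem_coe, hχ] at hg
      obtain ⟨s, hs, rfl⟩ := hg
      obtain ⟨e, hse, he, hdvd⟩ :=
        (exists_lstep_iff ha (hbt m hm) (hGm _ s hs).1 (hGm _ s hs).2).mp ⟨h', hstep⟩
      exact notMem_of_corner_le (hDfer _) hs hse (hp _ (hbt m hm) e he hdvd)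
    · rw [hJ', Ideal.mem_comap, map_sub, toAlg_rep] at hpJ
      exact hpJ

end Existence

end ChainCode

end

/-! ### Assembly of the generator matrix from the projection ideals -/

theorem theorem1 {R : Type*} [CommRing R] [Finite R] [IsLocalRing R]
    (a : R) (ha : IsLocalRing.maximalIdeal R = Ideal.span {a})
    (t : ℕ) (ht : t = nilpotencyClass a)
    (q : ℕ) (hq : q = Nat.card (IsLocalRing.ResidueField R))
    {r : ℕ} (T : Fin r → R[X]) (hT : ∀ j, (T j).Monic)
    (n : ℕ) (hn : n = ∏ j, (T j).natDegree)
    (ord : MonomialOrder (Fin r))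
    {l : ℕ} (C : Submodule (AffineAlgebra T) (Fin l → AffineAlgebra T)) (hC : C ≠ ⊥) :
    ∃ (k : ℕ) (i : Fin k → Fin l) (x : Fin k → ℕ)
      (F : Fin k → ℕ → Finset (Fin r →₀ ℕ)) (b : Fin k → ℕ → ℕ)
      (χ : Fin k → ℕ → Finset (MvPolynomial (Fin r) R))
      (h : RowIndex x χ → Fin l → AffineAlgebra T),
      1 ≤ k ∧ k ≤ l ∧ StrictMono i ∧ (∀ j, x j ≤ t - 1) ∧
      (∀ s : Fin l, (∃ j, i j = s) ↔ projIdeal C s ≠ ⊥) ∧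
      (∀ j, IsCGS ord a T hT (projIdeal C (i j)) (x j) (F j) (b j) (χ j)) ∧
      Nat.card C = q ^ ∑ j, cardExponent t n (x j) (b j) (F j) ∧
      (∀ (ρ : RowIndex x χ) (j' : Fin k), ρ.1 < j' →
        IsNormal ord a (unionSystem a (x j') (b j') (χ j')) (rep T hT (h ρ (i j')))) ∧
      IsGeneratorMatrix
        (Matrix.of fun ρ : RowIndex x χ =>
          rowVector (i ρ.1) (toAlg T (MvPolynomial.C (a ^ b ρ.1 ρ.2.1) * ρ.2.2.1)) (h ρ)) C := by
  classical
  subst ht hq hn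
  have hnil : IsNilpotent a := by
    obtain ⟨k, hk⟩ := IsArtinianRing.isNilpotent_jacobson_bot (R := R)
    refine ⟨k, ?_⟩
    have hmem : a ∈ Ideal.jacobson (⊥ : Ideal R) := by
      rw [IsLocalRing.jacobson_eq_maximalIdeal ⊥ bot_ne_top, ha]
      exact Ideal.mem_span_singleton_self a
    have := Ideal.pow_mem_pow hmem k
    rwa [hk] at this
  -- The data are chosen at every position, including those with zero projection ideal, so that the
  -- sweep over later entries needs no case distinction.
  choose X F b χ hX hcgs hnf using fun s : Fin l =>
    exists_isCGS ha hnil ord T hT (projIdeal C s)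
  let P : Finset (Fin l) := Finset.univ.filter fun s => projIdeal C s ≠ ⊥
  let i : Fin P.card → Fin l := P.orderEmbOfFin rfl
  have hi : ∀ s : Fin l, (∃ j, i j = s) ↔ projIdeal C s ≠ ⊥ := by
    intro s
    have : s ∈ Set.range i ↔ s ∈ P := by
      rw [Finset.range_orderEmbOfFin, Finset.mem_coe]
    simpa [P] using this
  have hrow : ∀ ρ : RowIndex (fun j => X (i j)) (fun j => χ (i j)),
      ∃ c ∈ C, rowVector (i ρ.1)
          (toAlg T (MvPolynomial.C (a ^ b (i ρ.1) ρ.2.1) * ρ.2.2.1)) c = c ∧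
        ∀ z, i ρ.1 < z → IsNormal ord a (unionSystem a (X z) (b z) (χ z)) (rep T hT (c z)) := by
    rintro ⟨j, m, g, hg⟩
    obtain ⟨c, hc, hc0, hci⟩ := mem_projIdeal.mp
      ((hcgs (i j)).krull_mem m (Nat.lt_succ_iff.mp m.2) g hg)
    obtain ⟨c', hc', heq, hn⟩ := exists_mem_forall_normal hnf hc (i j)
    refine ⟨c', hc', funext fun z => ?_, hn⟩
    simp only [rowVector]
    split_ifs with h1 h2
    · rw [heq z h1.le, hc0 z h1]
    · rw [h2, heq _ le_rfl, hci]
    · rfl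
  choose h hhC hhrow hhn using hrow
  refine ⟨P.card, i, fun j => X (i j), fun j => F (i j), fun j => b (i j), fun j => χ (i j), h,
    ?_, ?_, (P.orderEmbOfFin rfl).strictMono, fun j => hX _, hi, fun j => hcgs _, ?_, ?_, ?_⟩
  · by_contra hP
    apply hC
    symm
    refine eq_of_projIdeal_le bot_le fun s => ?_
    have hs : projIdeal C s = ⊥ := by
      by_contra hs
      have : s ∈ P := by simpa [P] using hs
      exact hP (Finset.card_pos.mpr ⟨s, this⟩)
    rw [hs]
    exact bot_le
  · simpa using Finset.card_le_univ P
  · rw [card_eq_prod_projIdeal, ← Finset.prod_pow_eq_pow_sum,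
      ← Finset.prod_subset (Finset.subset_univ P)]
    · have himage : Finset.univ.image i = P := Finset.image_orderEmbOfFin_univ P rfl
      have hprod : ∏ s ∈ P, Nat.card (projIdeal C s) = ∏ j, Nat.card (projIdeal C (i j)) := by
        conv_lhs => rw [← himage]
        exact Finset.prod_image fun _ _ _ _ h => (P.orderEmbOfFin rfl).injective h
      rw [hprod]
      exact Finset.prod_congr rfl fun j _ => (hcgs (i j)).card_eq
    · intro s _ hs
      have : projIdeal C s = ⊥ := by simpa [P] using hs
      rw [this]
      simp
  · exact fun ρ j' hj => hhn ρ (i j') ((P.orderEmbOfFin rfl).strictMono hj)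
  · have hM : (Matrix.of fun ρ : RowIndex (fun j => X (i j)) (fun j => χ (i j)) =>
        rowVector (i ρ.1) (toAlg T (MvPolynomial.C (a ^ b (i ρ.1) ρ.2.1) * ρ.2.2.1)) (h ρ)) =
        Matrix.of h := by
      ext ρ z
      exact congrFun (hhrow ρ) z
    -- Only projection ideals need comparing: at position `i j` the leading entries of the rows are
    -- exactly the generators supplied by `generates`.
    have hgoal : IsGeneratorMatrix (Matrix.of h) C := by
      refine eq_of_projIdeal_le (Submodule.span_le.mpr ?_) fun s => ?_
      · rintro _ ⟨ρ, rfl⟩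
        exact hhC ρ
      · by_cases hs : projIdeal C s = ⊥
        · rw [hs]
          exact bot_le
        · obtain ⟨j, rfl⟩ := (hi s).mpr hs
          conv_lhs => rw [← (hcgs (i j)).generates]
          refine Ideal.span_le.mpr ?_
          rintro _ ⟨_, ⟨m, hm, g, hg, rfl⟩, rfl⟩
          let ρ : RowIndex (fun j => X (i j)) (fun j => χ (i j)) :=
            ⟨j, ⟨m, Nat.lt_succ_of_le hm⟩, g, hg⟩
          refine mem_projIdeal.mpr ⟨h ρ, Submodule.subset_span ⟨ρ, rfl⟩, fun z hz => ?_, ?_⟩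
          · rw [← hhrow ρ]
            exact if_pos hz
          · rw [← hhrow ρ]
            simp [rowVector, ρ]
    rw [← hM] at hgoal
    exact hgoal
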